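/- For real $\alpha>-1$, $\beta>-1$ and $n\ge 1$ let $$P_n^{(\alpha,\beta)}(x)=\frac{(\alpha+1)_n}{n!}\sum_{k=0}^{n}\frac{(-n)_k\,(n+\alpha+\beta+1)_k}{k!\,(\alpha+1)_k}\left(\frac{1-x}{2}\right)^k,\qquad (a)_k=a(a+1)\cdots(a+k-1),$$ be the Jacobi polynomial, and let $$\phi_n^{(\alpha,\beta)}(\mu)=\sum_{k=0}^{\lfloor n/2\rfloor}\left.\frac{d^{2k}}{dx^{2k}}P_n^{(\alpha,\beta)}(x)\right|_{x=1}\mu^k .$$ The zeros of two real polynomials $g$ and $h$ are said to interlace (strictly) if all (complex) zeros of $g$ and of $h$ are real and simple, $g$ and $h$ have no common zero, between each two consecutive zeros of $g$ there is exactly one zero of $h$, and between each two consecutive zeros of $h$ there is exactly one zero of $g$. **Theorem.** Suppose that one of the following holds: $-1<\alpha<0$ and $\beta>-1$; or $0\le\alpha<1$ and $\beta>0$; or $1\le\alpha<2$ and $\beta>1$. Then for every integer $n\ge 4$ the zeros of $\phi_n^{(\alpha,\beta)}$ and $\phi_{n-1}^{(\alpha,\beta)}$ interlace strictly. -/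

import Mathlib

noncomputable section

/-- The Jacobi polynomial `P_n^{(α,β)}` in the normalization `P_n^{(α,β)}(1) = (α+1)_n / n!`:
`P_n^{(α,β)}(x) = (α+1)_n / n! * ∑_k (-n)_k (n+α+β+1)_k / (k! (α+1)_k) * ((1-x)/2)^k`,
where `(a)_k = a (a+1) ⋯ (a+k-1)` is `(ascPochhammer ℝ k).eval a`. The terms with `k > n`
vanish because `(-n)_k = 0`. (The formula is used for `α > -1`, where `(α+1)_k ≠ 0`.) -/
def jacobiPoly (n : ℕ) (α β : ℝ) : Polynomial ℝ :=
  Polynomial.C ((ascPochhammer ℝ n).eval (α + 1) / (n.factorial : ℝ)) *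
    ∑ k ∈ Finset.range (n + 1),
      Polynomial.C ((ascPochhammer ℝ k).eval (-(n : ℝ)) *
          (ascPochhammer ℝ k).eval ((n : ℝ) + α + β + 1) /
          ((k.factorial : ℝ) * (ascPochhammer ℝ k).eval (α + 1))) *
        (Polynomial.C (1 / 2 : ℝ) * (1 - Polynomial.X)) ^ k

/-- `φ_n^{(α,β)}(μ) = ∑_{k=0}^{⌊n/2⌋} (d^{2k}/dx^{2k} P_n^{(α,β)})(1) μ^k`. -/
def jacobiPhi (n : ℕ) (α β : ℝ) : Polynomial ℝ :=
  ∑ k ∈ Finset.range (n / 2 + 1),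
    Polynomial.C ((Polynomial.derivative^[2 * k] (jacobiPoly n α β)).eval 1) * Polynomial.X ^ k

/-- All complex zeros of the real polynomial `g` are real and simple. -/
def HasSimpleRealZeros (g : Polynomial ℝ) : Prop :=
  g ≠ 0 ∧ (∀ z : ℂ, Polynomial.aeval z g = 0 → z.im = 0) ∧
    ∀ x : ℝ, g.IsRoot x → g.rootMultiplicity x = 1

/-- Between each two consecutive real zeros of `g` there is exactly one zero of `h`. -/
def OneZeroBetween (g h : Polynomial ℝ) : Prop :=
  ∀ a b : ℝ, a < b → g.IsRoot a → g.IsRoot b → (∀ c ∈ Set.Ioo a b, ¬ g.IsRoot c) →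
    ∃! c : ℝ, c ∈ Set.Ioo a b ∧ h.IsRoot c

/-- The zeros of `g` and `h` interlace strictly: they are all real and simple, `g` and `h` are
coprime, and between each two consecutive zeros of either polynomial there is exactly one zero
of the other. -/
def StrictlyInterlace (g h : Polynomial ℝ) : Prop :=
  HasSimpleRealZeros g ∧ HasSimpleRealZeros h ∧ IsCoprime g h ∧
    OneZeroBetween g h ∧ OneZeroBetween h g

end

/-!
The first step identifies the span of two consecutive polynomials. In terms of the Taylor
coefficients `u_j` of `P_n^{(α,β-1)}` at `1` (the values of its derivatives), the coefficients for
`P_n^{(α,β)}` are `(n + α + β + j) / (n + α + β) * u_j`, and those for `P_{n-1}^{(α,β)}` are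
`(n - j) / (n + α) * u_j`. Hence, with `U = φ_n^{(α,β-1)}`, both `φ_n^{(α,β)}` and
`φ_{n-1}^{(α,β)}` are combinations of `U` and `X U'`, and the two combinations are linearly
independent (`jacobiPhi_eq_combination`, `jacobiPhi_eq_combination_succ`). If all zeros `ξ` of `U`
are simple and negative, then `z U'(z) / U(z) = ∑ z / (z - ξ)` is non-real off the real axis and
strictly increasing between its poles on it, so that any two independent combinations of `U` and
`X U'` interlace (`HasSimpleNegativeZeros.strictlyInterlace_combinations`).

It remains to show that `φ_n^{(α,β-1)}` has only simple negative zeros. By the Hermite–Biehler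
theorem (`hasSimpleNegativeZeros_of_stable`) the even and odd parts of a Hurwitz stable polynomial
have this property. The even part of `∑_k (d^k/dx^k P_n^{(α,β)})(1) z^k` is `φ_n^{(α,β)}`, and its
odd part is a multiple of `φ_{n-1}^{(α+1,β+1)}` (`jacobiGen_eq_even_add_odd`). For `α < 1` the even
part for the parameters `(α, β - 1)` serves, for `1 ≤ α` the odd part for `(α - 1, β - 2)`.

Stability (`re_neg_of_aeval_jacobiGen_eq_zero`) is an energy estimate. The polynomial
`f = ∑_k z^k P^{(k)}`, where `P = P_n^{(α,β)}`, solves `f - z f' = P`, and `z` is a zero of the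
generating polynomial exactly if `f(1) = 0`. For the weight `(1-x)^α (1+x)^(β+1)`, whose second
exponent is one larger than the natural one, `P` is still orthogonal to all polynomials of degree at
most `n - 2`, and its moments against `(1+x)^(n-1)` and `(1+x)^n` are positive
(`jacobiIntegral_jacobiPoly_mul`, by the Chu–Vandermonde identity). Testing the equation against the
conjugate of `f / (1 - x)` when `α < 1` and `β > -1`, or of `(1 + x) f'` when `α ≤ 0` and `β > -2`,
and integrating by parts, every term that is not annihilated by orthogonality has a sign, and these
signs force `Re z < 0` (`re_neg_of_resolvent_root`, `re_neg_of_resolvent_root_of_nonpos`).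
-/

open Polynomial

/-! ### Interlacing from a non-vanishing Wronskian -/

/-- If the Wronskian of `g` and `h` has no real zero, Rolle's theorem applied to `g / h` yields a
zero of `h` between two zeros of `g`, and applied to `h / g` it shows that there is only one. -/
lemma oneZeroBetween_of_wronskian_ne_zero {g h : ℝ[X]}
    (hW : ∀ x, g.eval x * h.derivative.eval x - g.derivative.eval x * h.eval x ≠ 0) :
    OneZeroBetween g h := by
  have rolle : ∀ p q : ℝ[X], (∀ x, p.eval x * q.derivative.eval x -
      p.derivative.eval x * q.eval x ≠ 0) → ∀ a b : ℝ, a < b → p.eval a = 0 → p.eval b = 0 →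
      ∃ c ∈ Set.Icc a b, q.eval c = 0 := by
    intro p q hpq a b hab ha hb
    by_contra! hne
    have hd : ∀ x ∈ Set.Icc a b, HasDerivAt (fun x => p.eval x / q.eval x)
        ((p.derivative.eval x * q.eval x - p.eval x * q.derivative.eval x) / q.eval x ^ 2) x :=
      fun x hx => (p.hasDerivAt x).div (q.hasDerivAt x) (hne x hx)
    obtain ⟨c, hc, hc0⟩ := exists_hasDerivAt_eq_zero hab
      (fun x hx => (hd x hx).continuousAt.continuousWithinAt) (by simp [ha, hb])
      (fun x hx => hd x (Set.Ioo_subset_Icc_self hx))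
    have hc' := hne c (Set.Ioo_subset_Icc_self hc)
    rw [div_eq_zero_iff] at hc0
    rcases hc0 with h0 | h0
    · exact hpq c (by linarith)
    · exact hc' (pow_eq_zero_iff (two_ne_zero) |>.1 h0)
  intro a b hab ha hb hgap
  have ha' : g.eval a = 0 := ha
  have hb' : g.eval b = 0 := hb
  obtain ⟨c, hc, hc0⟩ := rolle g h hW a b hab ha' hb'
  have hca : c ≠ a := by
    rintro rfl
    exact hW c (by rw [ha', hc0]; ring)
  have hcb : c ≠ b := by
    rintro rfl
    exact hW c (by rw [hb', hc0]; ring)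
  have hW' : ∀ x, h.eval x * g.derivative.eval x - h.derivative.eval x * g.eval x ≠ 0 :=
    fun x hx => hW x (by linarith)
  have hlt : ∀ c d : ℝ, c ∈ Set.Ioo a b → d ∈ Set.Ioo a b → h.eval c = 0 → h.eval d = 0 →
      ¬ c < d := by
    intro c d hc hd hc0 hd0 hcd
    obtain ⟨e, he, he0⟩ := rolle h g hW' c d hcd hc0 hd0
    exact hgap e ⟨hc.1.trans_le he.1, he.2.trans_lt hd.2⟩ he0
  have hcm : c ∈ Set.Ioo a b := ⟨lt_of_le_of_ne hc.1 hca.symm, lt_of_le_of_ne hc.2 hcb⟩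
  refine ⟨c, ⟨hcm, hc0⟩, ?_⟩
  rintro d ⟨hd, hd0⟩
  exact le_antisymm (not_lt.1 (hlt c d hcm hd hc0 hd0)) (not_lt.1 (hlt d c hd hcm hd0 hc0))

lemma rootMultiplicity_eq_one_of_derivative_ne_zero {g : ℝ[X]} (hg : g ≠ 0) {x : ℝ}
    (hx : g.IsRoot x) (hd : g.derivative.eval x ≠ 0) : g.rootMultiplicity x = 1 := by
  have h1 := (rootMultiplicity_pos hg).2 hx
  have h2 : ¬ 1 < g.rootMultiplicity x := fun h =>
    hd ((one_lt_rootMultiplicity_iff_isRoot hg).1 h).2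
  omega

lemma aeval_ofReal_eq_zero_iff {g : ℝ[X]} {z : ℂ} (hz : z.im = 0) :
    aeval z g = 0 ↔ g.eval z.re = 0 := by
  have : z = algebraMap ℝ ℂ z.re := Complex.ext (by simp) (by simp [hz])
  rw [this, aeval_algebraMap_apply_eq_algebraMap_eval]
  simp

lemma strictlyInterlace_of_wronskian_ne_zero {g h : ℝ[X]}
    (hg : ∀ z : ℂ, aeval z g = 0 → z.im = 0) (hh : ∀ z : ℂ, aeval z h = 0 → z.im = 0)
    (hW : ∀ x, g.eval x * h.derivative.eval x - g.derivative.eval x * h.eval x ≠ 0) :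
    StrictlyInterlace g h := by
  have hW' : ∀ x, h.eval x * g.derivative.eval x - h.derivative.eval x * g.eval x ≠ 0 :=
    fun x hx => hW x (by linarith)
  have key : ∀ p q : ℝ[X], (∀ x, p.eval x * q.derivative.eval x -
      p.derivative.eval x * q.eval x ≠ 0) → (∀ z : ℂ, aeval z p = 0 → z.im = 0) →
      HasSimpleRealZeros p := by
    intro p q hpq hp
    have hp0 : p ≠ 0 := by
      rintro rfl
      exact hpq 0 (by simp)
    refine ⟨hp0, hp, fun x hx => rootMultiplicity_eq_one_of_derivative_ne_zero hp0 hx ?_⟩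
    intro hd
    have hx' : p.eval x = 0 := hx
    exact hpq x (by rw [hx', hd]; ring)
  refine ⟨key g h hW hg, key h g hW' hh, ?_, oneZeroBetween_of_wronskian_ne_zero hW,
    oneZeroBetween_of_wronskian_ne_zero hW'⟩
  rw [isCoprime_iff_aeval_ne_zero_of_isAlgClosed ℝ ℂ]
  intro z
  by_contra! hz
  have hz0 := hg z hz.1
  have h1 := (aeval_ofReal_eq_zero_iff hz0).1 hz.1
  have h2 := (aeval_ofReal_eq_zero_iff hz0).1 hz.2
  exact hW z.re (by rw [h1, h2]; ring)

/-! ### Combinations of a polynomial and its Euler derivative -/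

/-- All complex zeros of the real polynomial `U` are real, negative and simple. -/
def HasSimpleNegativeZeros (U : ℝ[X]) : Prop :=
  U ≠ 0 ∧ (∀ z : ℂ, aeval z U = 0 → z.im = 0 ∧ z.re < 0) ∧
    ∀ x : ℝ, U.eval x = 0 → U.derivative.eval x ≠ 0

lemma HasSimpleNegativeZeros.of_C_mul {U : ℝ[X]} {c : ℝ} (h : HasSimpleNegativeZeros (C c * U)) :
    HasSimpleNegativeZeros U := by
  obtain ⟨h0, hz, hs⟩ := h
  refine ⟨right_ne_zero_of_mul h0, fun z hz' => hz z (by simp [hz']), fun x hx hd => ?_⟩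
  exact hs x (by simp [hx]) (by simp [hd])

lemma HasSimpleNegativeZeros.eq_prod {U : ℝ[X]} (h : HasSimpleNegativeZeros U) :
    ∃ s : Multiset ℝ, (∀ ξ ∈ s, ξ < 0) ∧ Multiset.card s = U.natDegree ∧
      U = C U.leadingCoeff * (s.map fun ξ => X - C ξ).prod := by
  have hroot : ∀ z : ℂ, z ∈ (U.map (algebraMap ℝ ℂ)).roots → z.im = 0 ∧ z.re < 0 := by
    intro z hz
    apply h.2.1
    have := isRoot_of_mem_roots hz
    rwa [IsRoot.def, eval_map_algebraMap] at this
  have hsplit : U.Splits := by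
    refine Splits.of_splits_map (algebraMap ℝ ℂ) (IsAlgClosed.splits _) fun z hz => ?_
    exact ⟨z.re, Complex.ext (by simp) (by simp [(hroot z hz).1])⟩
  refine ⟨U.roots, fun ξ hξ => ?_, hsplit.natDegree_eq_card_roots.symm, hsplit.eq_prod_roots⟩
  have hξ' : U.eval ξ = 0 := isRoot_of_mem_roots hξ
  have := h.2.1 (ξ : ℂ) ((aeval_ofReal_eq_zero_iff (by simp)).2 (by simpa using hξ'))
  simpa using this.2

/-- The Euler logarithmic derivative `z V'(z) / V(z) = ∑ z / (z - ξ)` of a polynomial with negative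
zeros `ξ` maps the upper half plane into itself. -/
lemma im_euler_mul_conj_pos (s : Multiset ℝ) (hs : ∀ ξ ∈ s, ξ < 0) {z : ℂ} (hz : 0 < z.im) :
    0 ≤ (z * aeval z (s.map fun ξ => X - C ξ).prod.derivative *
        (starRingEnd ℂ) (aeval z (s.map fun ξ => X - C ξ).prod)).im ∧
      (s ≠ 0 → 0 < (z * aeval z (s.map fun ξ => X - C ξ).prod.derivative *
        (starRingEnd ℂ) (aeval z (s.map fun ξ => X - C ξ).prod)).im) ∧
      aeval z (s.map fun ξ => X - C ξ).prod ≠ 0 := by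
  induction s using Multiset.induction_on with
  | empty => simp
  | cons ξ s ih =>
    obtain ⟨h0, -, hne⟩ := ih fun η hη => hs η (Multiset.mem_cons_of_mem hη)
    have hξ : ξ < 0 := hs ξ (Multiset.mem_cons_self ξ s)
    set V := (s.map fun ξ => X - C ξ).prod with hV
    have hfac : z - (ξ : ℂ) ≠ 0 := fun h => by
      have := congrArg Complex.im h
      simp at this
      exact hz.ne' this
    have hpos : 0 < (z * aeval z ((X - C ξ) * V).derivative *
        (starRingEnd ℂ) (aeval z ((X - C ξ) * V))).im := by
      have e : z * aeval z ((X - C ξ) * V).derivative * (starRingEnd ℂ) (aeval z ((X - C ξ) * V))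
          = (Complex.normSq (z - ξ) : ℂ) * (z * aeval z V.derivative * (starRingEnd ℂ) (aeval z V))
            + (Complex.normSq (aeval z V) : ℂ) * (z * (starRingEnd ℂ) (z - ξ)) := by
        rw [← Complex.mul_conj, ← Complex.mul_conj]
        simp [derivative_mul]
        ring
      have e2 : (z * (starRingEnd ℂ) (z - ξ)).im = -ξ * z.im := by
        simp [Complex.mul_im]
        ring
      rw [e, Complex.add_im, Complex.im_ofReal_mul, Complex.im_ofReal_mul, e2]
      have h1 := Complex.normSq_nonneg (z - ξ)
      have h2 := Complex.normSq_pos.2 hne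
      have h3 : 0 < -ξ * z.im := mul_pos (by linarith) hz
      positivity
    rw [Multiset.map_cons, Multiset.prod_cons]
    refine ⟨hpos.le, fun _ => hpos, ?_⟩
    rw [map_mul]
    exact mul_ne_zero (by simpa using hfac) hne

/-- Monotonicity of the Euler logarithmic derivative on the real line: the expression is the numerator
`V · (X V')' - V' · X V'` of `(X V' / V)' = ∑ -ξ / (X - ξ)²`. -/
lemma euler_wronskian_pos_of_ne_zero (s : Multiset ℝ) (hs : ∀ ξ ∈ s, ξ < 0) (x : ℝ) :
    0 ≤ (s.map fun ξ => X - C ξ).prod.eval x *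
          (X * (s.map fun ξ => X - C ξ).prod.derivative).derivative.eval x -
        (s.map fun ξ => X - C ξ).prod.derivative.eval x *
          (X * (s.map fun ξ => X - C ξ).prod.derivative).eval x ∧
      (s ≠ 0 → (s.map fun ξ => X - C ξ).prod.eval x ≠ 0 →
        0 < (s.map fun ξ => X - C ξ).prod.eval x *
          (X * (s.map fun ξ => X - C ξ).prod.derivative).derivative.eval x -
        (s.map fun ξ => X - C ξ).prod.derivative.eval x *
          (X * (s.map fun ξ => X - C ξ).prod.derivative).eval x) := by
  induction s using Multiset.induction_on with
  | empty => simp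
  | cons ξ s ih =>
    obtain ⟨h0, -⟩ := ih fun η hη => hs η (Multiset.mem_cons_of_mem hη)
    have hξ : ξ < 0 := hs ξ (Multiset.mem_cons_self ξ s)
    rw [Multiset.map_cons, Multiset.prod_cons]
    set V := (s.map fun ξ => X - C ξ).prod with hV
    have e : ((X - C ξ) * V).eval x * (X * ((X - C ξ) * V).derivative).derivative.eval x -
          ((X - C ξ) * V).derivative.eval x * (X * ((X - C ξ) * V).derivative).eval x
        = (x - ξ) ^ 2 * (V.eval x * (X * V.derivative).derivative.eval x -
          V.derivative.eval x * (X * V.derivative).eval x) + -ξ * V.eval x ^ 2 := by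
      simp [derivative_mul]
      ring
    rw [e]
    have hξ' : 0 < -ξ := by linarith
    refine ⟨by positivity, fun _ hne => ?_⟩
    have hVx : V.eval x ≠ 0 := by
      rw [eval_mul] at hne
      exact right_ne_zero_of_mul hne
    have : 0 < V.eval x ^ 2 := by positivity
    positivity

lemma HasSimpleNegativeZeros.euler_wronskian_pos {U : ℝ[X]} (h : HasSimpleNegativeZeros U)
    (hdeg : 0 < U.natDegree) (x : ℝ) :
    0 < U.eval x * (X * U.derivative).derivative.eval x -
      U.derivative.eval x * (X * U.derivative).eval x := by
  by_cases hx : U.eval x = 0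
  · have hneg : x < 0 := by
      simpa using (h.2.1 (x : ℂ) ((aeval_ofReal_eq_zero_iff (by simp)).2 (by simpa using hx))).2
    have hd := h.2.2 x hx
    have : 0 < U.derivative.eval x ^ 2 := by positivity
    have e : U.eval x * (X * U.derivative).derivative.eval x -
        U.derivative.eval x * (X * U.derivative).eval x = -x * U.derivative.eval x ^ 2 := by
      rw [hx]
      simp
      ring
    rw [e]
    exact mul_pos (by linarith) this
  · obtain ⟨s, hs, hcard, hU⟩ := h.eq_prod
    have hs0 : s ≠ 0 := by
      rintro rfl
      simp at hcard
      omega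
    have hpos := (euler_wronskian_pos_of_ne_zero s hs x).2 hs0
    set V := (s.map fun ξ => X - C ξ).prod
    have hc : U.leadingCoeff ≠ 0 := leadingCoeff_ne_zero.2 h.1
    set c := U.leadingCoeff
    have hVx : V.eval x ≠ 0 := fun h0 => hx (by rw [hU]; simp [h0])
    have e : U.eval x * (X * U.derivative).derivative.eval x -
        U.derivative.eval x * (X * U.derivative).eval x =
        c ^ 2 * (V.eval x * (X * V.derivative).derivative.eval x -
          V.derivative.eval x * (X * V.derivative).eval x) := by
      rw [hU]
      simp [derivative_mul]
      ring
    rw [e]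
    have : 0 < c ^ 2 := by positivity
    exact mul_pos this (hpos hVx)

lemma HasSimpleNegativeZeros.im_eq_zero_of_aeval_combination {U : ℝ[X]}
    (h : HasSimpleNegativeZeros U) (hdeg : 0 < U.natDegree) {a b : ℝ} (hab : a ≠ 0 ∨ b ≠ 0)
    {z : ℂ} (hz : aeval z (C a * U + C b * (X * U.derivative)) = 0) : z.im = 0 := by
  obtain ⟨s, hs, hcard, hU⟩ := h.eq_prod
  have hs0 : s ≠ 0 := by
    rintro rfl
    simp at hcard
    omega
  have hc : U.leadingCoeff ≠ 0 := leadingCoeff_ne_zero.2 h.1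
  set V := (s.map fun ξ => X - C ξ).prod with hV
  have hzV : (a : ℂ) * aeval z V + b * (z * aeval z V.derivative) = 0 := by
    rw [hU] at hz
    have : (U.leadingCoeff : ℂ) * ((a : ℂ) * aeval z V + b * (z * aeval z V.derivative)) = 0 := by
      rw [← hz]
      simp [derivative_mul]
      ring
    simpa [hc] using this
  have upper : ∀ w : ℂ, (a : ℂ) * aeval w V + b * (w * aeval w V.derivative) = 0 →
      ¬ 0 < w.im := by
    intro w hw hpos
    obtain ⟨-, h1, h2⟩ := im_euler_mul_conj_pos s hs hpos
    have h1 := h1 hs0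
    rw [← hV] at h1 h2
    have e : (a : ℂ) * (Complex.normSq (aeval w V) : ℂ) +
        (b : ℂ) * (w * aeval w V.derivative * (starRingEnd ℂ) (aeval w V)) = 0 := by
      rw [← Complex.mul_conj]
      linear_combination (starRingEnd ℂ) (aeval w V) * hw
    have eim := congrArg Complex.im e
    rw [Complex.add_im, Complex.im_ofReal_mul, Complex.im_ofReal_mul] at eim
    simp only [Complex.ofReal_im, mul_zero, zero_add, Complex.zero_im, mul_eq_zero, h1.ne',
      or_false] at eim
    rw [eim] at hw
    have ha : a ≠ 0 := by simpa [eim] using hab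
    simp [ha, h2] at hw
  have hconj : ∀ p : ℝ[X], aeval ((starRingEnd ℂ) z) p = (starRingEnd ℂ) (aeval z p) := by
    intro p
    simpa using aeval_algHom_apply (Complex.conjAe : ℂ →ₐ[ℝ] ℂ) z p
  have hzc : (a : ℂ) * aeval ((starRingEnd ℂ) z) V +
      b * ((starRingEnd ℂ) z * aeval ((starRingEnd ℂ) z) V.derivative) = 0 := by
    rw [hconj, hconj]
    simpa using congrArg (starRingEnd ℂ) hzV
  have h1 := upper z hzV
  have h2 := upper _ hzc
  rw [Complex.conj_im] at h2
  linarith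

/-- Two independent combinations of `U` and `X U'` interlace: their Wronskian is a constant multiple
of that of `U` and `X U'`, which is positive on the real line. -/
lemma HasSimpleNegativeZeros.strictlyInterlace_combinations {U : ℝ[X]}
    (h : HasSimpleNegativeZeros U) (hdeg : 0 < U.natDegree) {a b c d : ℝ}
    (hdet : a * d - b * c ≠ 0) :
    StrictlyInterlace (C a * U + C b * (X * U.derivative))
      (C c * U + C d * (X * U.derivative)) := by
  refine strictlyInterlace_of_wronskian_ne_zero
    (fun z => h.im_eq_zero_of_aeval_combination hdeg ?_)
    (fun z => h.im_eq_zero_of_aeval_combination hdeg ?_) fun x => ?_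
  · by_contra! h0
    exact hdet (by rw [h0.1, h0.2]; ring)
  · by_contra! h0
    exact hdet (by rw [h0.1, h0.2]; ring)
  · have hpos := h.euler_wronskian_pos hdeg x
    have e : (C a * U + C b * (X * U.derivative)).eval x *
          (C c * U + C d * (X * U.derivative)).derivative.eval x -
        (C a * U + C b * (X * U.derivative)).derivative.eval x *
          (C c * U + C d * (X * U.derivative)).eval x =
        (a * d - b * c) * (U.eval x * (X * U.derivative).derivative.eval x -
          U.derivative.eval x * (X * U.derivative).eval x) := by
      simp [derivative_mul]
      ring
    rw [e]
    exact mul_ne_zero hdet hpos.ne'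

/-! ### Even and odd parts of a Hurwitz stable polynomial -/

/-- A polynomial with zeros in the open left half plane is larger in modulus at a point `z` of the
right half plane than at the mirror image `-conj z`, factor by factor. -/
lemma normSq_eval_neg_conj_lt (s : Multiset ℂ) (hs : ∀ w ∈ s, w.re < 0) {z : ℂ} (hz : 0 < z.re) :
    Complex.normSq ((s.map fun w => X - C w).prod.eval (-(starRingEnd ℂ) z)) ≤
        Complex.normSq ((s.map fun w => X - C w).prod.eval z) ∧
      (s ≠ 0 → Complex.normSq ((s.map fun w => X - C w).prod.eval (-(starRingEnd ℂ) z)) <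
        Complex.normSq ((s.map fun w => X - C w).prod.eval z)) ∧
      (s.map fun w => X - C w).prod.eval z ≠ 0 := by
  induction s using Multiset.induction_on with
  | empty => simp
  | cons w s ih =>
    obtain ⟨h0, -, hne⟩ := ih fun v hv => hs v (Multiset.mem_cons_of_mem hv)
    have hw : w.re < 0 := hs w (Multiset.mem_cons_self w s)
    rw [Multiset.map_cons, Multiset.prod_cons]
    set V := (s.map fun w => X - C w).prod with hV
    have hlt : Complex.normSq (-(starRingEnd ℂ) z - w) < Complex.normSq (z - w) := by
      simp only [Complex.normSq_apply, Complex.sub_re, Complex.neg_re, Complex.conj_re,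
        Complex.sub_im, Complex.neg_im, Complex.conj_im]
      nlinarith
    have hmain : Complex.normSq (((X - C w) * V).eval (-(starRingEnd ℂ) z)) <
        Complex.normSq (((X - C w) * V).eval z) := by
      simp only [eval_mul, eval_sub, eval_X, eval_C, map_mul]
      exact mul_lt_mul_of_lt_of_le_of_nonneg_of_pos hlt h0 (Complex.normSq_nonneg _)
        (Complex.normSq_pos.2 hne)
    refine ⟨hmain.le, fun _ => hmain, ?_⟩
    rw [eval_mul]
    refine mul_ne_zero (fun h => ?_) hne
    have := congrArg Complex.re h
    simp at this
    linarith

/-- The logarithmic derivative `∑ 1 / (z - w)` of a polynomial with zeros `w` in the open left half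
plane has positive real part on the closed right half plane. -/
lemma re_derivative_mul_conj_pos (s : Multiset ℂ) (hs : ∀ w ∈ s, w.re < 0) {z : ℂ}
    (hz : 0 ≤ z.re) :
    0 ≤ ((s.map fun w => X - C w).prod.derivative.eval z *
        (starRingEnd ℂ) ((s.map fun w => X - C w).prod.eval z)).re ∧
      (s ≠ 0 → 0 < ((s.map fun w => X - C w).prod.derivative.eval z *
        (starRingEnd ℂ) ((s.map fun w => X - C w).prod.eval z)).re) ∧
      (s.map fun w => X - C w).prod.eval z ≠ 0 := by
  induction s using Multiset.induction_on with
  | empty => simp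
  | cons w s ih =>
    obtain ⟨h0, -, hne⟩ := ih fun v hv => hs v (Multiset.mem_cons_of_mem hv)
    have hw : w.re < 0 := hs w (Multiset.mem_cons_self w s)
    rw [Multiset.map_cons, Multiset.prod_cons]
    set V := (s.map fun w => X - C w).prod with hV
    have hmain : 0 < (((X - C w) * V).derivative.eval z *
        (starRingEnd ℂ) (((X - C w) * V).eval z)).re := by
      have e : ((X - C w) * V).derivative.eval z * (starRingEnd ℂ) (((X - C w) * V).eval z) =
          (Complex.normSq (z - w) : ℂ) * (V.derivative.eval z * (starRingEnd ℂ) (V.eval z)) +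
            (Complex.normSq (V.eval z) : ℂ) * (starRingEnd ℂ) (z - w) := by
        rw [← Complex.mul_conj, ← Complex.mul_conj]
        simp [derivative_mul]
        ring
      rw [e, Complex.add_re, Complex.re_ofReal_mul, Complex.re_ofReal_mul, Complex.conj_re,
        Complex.sub_re]
      have h1 := Complex.normSq_nonneg (z - w)
      have h2 := Complex.normSq_pos.2 hne
      have h3 : 0 < z.re - w.re := by linarith
      positivity
    refine ⟨hmain.le, fun _ => hmain, ?_⟩
    rw [eval_mul]
    refine mul_ne_zero (fun h => ?_) hne
    have := congrArg Complex.re h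
    simp at this
    linarith

/-- Hermite–Biehler: the even and odd parts of a non-constant Hurwitz stable real polynomial, as
polynomials in `z²`, have only simple negative zeros. -/
theorem hasSimpleNegativeZeros_of_stable {F E O : ℝ[X]} (hdeg : 0 < F.natDegree)
    (hstable : ∀ z : ℂ, aeval z F = 0 → z.re < 0)
    (hF : F = E.comp (X ^ 2) + X * O.comp (X ^ 2)) :
    HasSimpleNegativeZeros E ∧ HasSimpleNegativeZeros O := by
  have hF0 : F ≠ 0 := by
    rintro rfl
    simp at hdeg
  obtain ⟨s, c, hc, hs0, hs, hfac⟩ : ∃ (s : Multiset ℂ) (c : ℂ), c ≠ 0 ∧ s ≠ 0 ∧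
      (∀ w ∈ s, w.re < 0) ∧ F.map (algebraMap ℝ ℂ) = C c * (s.map fun w => X - C w).prod := by
    have hsp : (F.map (algebraMap ℝ ℂ)).Splits := IsAlgClosed.splits _
    have hne : F.map (algebraMap ℝ ℂ) ≠ 0 := by
      rwa [Ne, Polynomial.map_eq_zero]
    refine ⟨_, _, leadingCoeff_ne_zero.2 hne, ?_, fun w hw => hstable w ?_, hsp.eq_prod_roots⟩
    · intro h
      have := hsp.natDegree_eq_card_roots
      rw [h, natDegree_map] at this
      simp at this
      omega
    · have := isRoot_of_mem_roots hw
      rwa [IsRoot.def, eval_map_algebraMap] at this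
  set V := (s.map fun w => X - C w).prod with hV
  have hev : ∀ z, aeval z F = c * V.eval z := by
    intro z
    rw [← eval_map_algebraMap, hfac]
    simp
  have hev' : ∀ z, aeval z F.derivative = c * V.derivative.eval z := by
    intro z
    rw [← eval_map_algebraMap, ← derivative_map, hfac]
    simp
  have hEO : ∀ z : ℂ, aeval z F = aeval (z ^ 2) E + z * aeval (z ^ 2) O := by
    intro z
    rw [hF]
    simp [aeval_comp]
  -- Off the imaginary axis neither part vanishes, because `|F z| ≠ |F (-z)|`.
  have hmod : ∀ z : ℂ, 0 < z.re → Complex.normSq (aeval (-z) F) < Complex.normSq (aeval z F) := by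
    intro z hz
    have h1 := (normSq_eval_neg_conj_lt s hs hz).2.1 hs0
    have h2 : Complex.normSq (aeval (-z) F) =
        Complex.normSq (aeval (-(starRingEnd ℂ) z) F) := by
      have := aeval_algHom_apply (Complex.conjAe : ℂ →ₐ[ℝ] ℂ) (-z) F
      have h3 : aeval (-(starRingEnd ℂ) z) F = (starRingEnd ℂ) (aeval (-z) F) := by
        simpa using this
      rw [h3, Complex.normSq_conj]
    rw [h2, hev, hev, map_mul, map_mul]
    exact mul_lt_mul_of_pos_left h1 (Complex.normSq_pos.2 hc)
  have hnz : ∀ z : ℂ, 0 < z.re → aeval (z ^ 2) E ≠ 0 ∧ aeval (z ^ 2) O ≠ 0 := by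
    intro z hz
    have h := hmod z hz
    rw [hEO, hEO z] at h
    refine ⟨fun h0 => ?_, fun h0 => ?_⟩ <;> simp [h0] at h
  -- Positivity of the Wronskian-type expression on the negative axis.
  have hwr : ∀ x : ℝ, x ≤ 0 → 0 < E.eval x * O.eval x + 2 * x * (E.eval x * O.derivative.eval x) -
      2 * x * (E.derivative.eval x * O.eval x) := by
    intro x hx
    have hy := Real.sq_sqrt (neg_nonneg.2 hx)
    set y := √(-x) with hy_def
    have hz2 : ((y : ℂ) * Complex.I) ^ 2 = (x : ℂ) := by
      rw [mul_pow, Complex.I_sq, ← Complex.ofReal_pow, hy]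
      simp
    have hpos := (re_derivative_mul_conj_pos s hs (z := (y : ℂ) * Complex.I) (by simp)).2.1 hs0
    have hre : ∀ p : ℝ[X], aeval (x : ℂ) p = ((p.eval x : ℝ) : ℂ) := by
      intro p
      simpa using aeval_algebraMap_apply_eq_algebraMap_eval (A := ℂ) x p
    have hA := hEO ((y : ℂ) * Complex.I)
    rw [hz2, hre, hre, hev] at hA
    have hB : aeval ((y : ℂ) * Complex.I) F.derivative =
        2 * ((y : ℂ) * Complex.I) * (E.derivative.eval x : ℝ) +
          ((O.eval x : ℝ) + 2 * x * (O.derivative.eval x : ℝ)) := by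
      rw [hF]
      simp only [derivative_comp, derivative_mul, derivative_X, derivative_X_pow,
        map_add, map_mul, aeval_comp, map_pow, aeval_X, hz2, hre, one_mul]
      have : ((y : ℂ) * Complex.I) * ((y : ℂ) * Complex.I) = x := by rw [← hz2]; ring
      simp
      linear_combination 2 * ((O.derivative.eval x : ℝ) : ℂ) * this
    rw [hev'] at hB
    have hnorm : 0 < Complex.normSq c := Complex.normSq_pos.2 hc
    have e : (Complex.normSq c : ℂ) * (V.derivative.eval ((y : ℂ) * Complex.I) *
        (starRingEnd ℂ) (V.eval ((y : ℂ) * Complex.I))) =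
        (2 * ((y : ℂ) * Complex.I) * (E.derivative.eval x : ℝ) +
          ((O.eval x : ℝ) + 2 * x * (O.derivative.eval x : ℝ))) *
        (starRingEnd ℂ) ((E.eval x : ℝ) + (y : ℂ) * Complex.I * (O.eval x : ℝ)) := by
      rw [← hA, ← hB, ← Complex.mul_conj, map_mul]
      ring
    have e' := congrArg Complex.re e
    rw [Complex.re_ofReal_mul] at e'
    have hpos' := mul_pos hnorm hpos
    rw [e'] at hpos'
    simp at hpos'
    refine hpos'.trans_eq ?_
    linear_combination 2 * (E.derivative.eval x * O.eval x) * hy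
  have hnonzero : ∀ p : ℝ[X], (∀ z : ℂ, 0 < z.re → aeval (z ^ 2) p ≠ 0) → p.eval 0 ≠ 0 →
      p ≠ 0 ∧ ∀ z : ℂ, aeval z p = 0 → z.im = 0 ∧ z.re < 0 := by
    intro p hp hp0
    refine ⟨?_, fun μ hμ => ?_⟩
    · rintro rfl
      simp at hp0
    obtain ⟨z, rfl⟩ := IsAlgClosed.exists_pow_nat_eq μ (n := 2) two_pos
    have h1 : ¬ 0 < z.re := fun h => hp z h hμ
    have h2 : ¬ 0 < (-z).re := fun h => hp (-z) h (by rwa [neg_sq])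
    have h3 : z.re = 0 := by
      rw [Complex.neg_re] at h2
      linarith
    have him : (z ^ 2).im = 0 := by simp [sq, h3]
    refine ⟨him, ?_⟩
    have h4 : (z ^ 2).re = -z.im ^ 2 := by simp [sq, h3]
    have h5 : z.im ≠ 0 := by
      intro h6
      have := (aeval_ofReal_eq_zero_iff him).1 hμ
      rw [h4, h6] at this
      exact hp0 (by simpa using this)
    rw [h4]
    have : 0 < z.im ^ 2 := by positivity
    linarith
  have hw0 := hwr 0 le_rfl
  simp only [mul_zero, zero_mul, add_zero, sub_zero] at hw0
  obtain ⟨hE0, hE⟩ := hnonzero E (fun z hz => (hnz z hz).1) (left_ne_zero_of_mul hw0.ne')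
  obtain ⟨hO0, hO⟩ := hnonzero O (fun z hz => (hnz z hz).2) (right_ne_zero_of_mul hw0.ne')
  have hneg : ∀ p : ℝ[X], (∀ z : ℂ, aeval z p = 0 → z.im = 0 ∧ z.re < 0) →
      ∀ x : ℝ, p.eval x = 0 → x ≤ 0 := by
    intro p hp x hx
    have := (hp (x : ℂ) ((aeval_ofReal_eq_zero_iff (by simp)).2 (by simpa using hx))).2
    simpa using this.le
  refine ⟨⟨hE0, hE, fun x hx hd => ?_⟩, ⟨hO0, hO, fun x hx hd => ?_⟩⟩
  · have := hwr x (hneg E hE x hx)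
    simp [hx, hd] at this
  · have := hwr x (hneg O hO x hx)
    simp [hx, hd] at this

/-! ### The Jacobi weight -/

lemma intervalIntegrable_jacobiWeight {a b : ℝ} (ha : -1 < a) (hb : -1 < b) :
    IntervalIntegrable (fun x : ℝ => (1 - x) ^ a * (1 + x) ^ b) MeasureTheory.volume (-1) 1 := by
  have h1 : IntervalIntegrable (fun x : ℝ => (1 + x) ^ b) MeasureTheory.volume (-1) 0 := by
    have := (intervalIntegral.intervalIntegrable_rpow' (a := 0) (b := 1) hb).comp_add_left 1
    simpa using this
  have h2 : IntervalIntegrable (fun x : ℝ => (1 - x) ^ a) MeasureTheory.volume 0 1 := by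
    have := (intervalIntegral.intervalIntegrable_rpow' (a := 1) (b := 0) ha).comp_sub_left 1
    simpa using this
  refine IntervalIntegrable.trans (b := 0) (h1.continuousOn_mul ?_) (h2.mul_continuousOn ?_)
  · refine ContinuousOn.rpow_const (by fun_prop) fun x hx => Or.inl ?_
    rw [Set.uIcc_of_le (by norm_num)] at hx
    linarith [hx.2]
  · refine ContinuousOn.rpow_const (by fun_prop) fun x hx => Or.inl ?_
    rw [Set.uIcc_of_le (by norm_num)] at hx
    linarith [hx.1]

lemma intervalIntegrable_mul_jacobiWeight {a b : ℝ} (ha : -1 < a) (hb : -1 < b) (p : ℝ[X]) :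
    IntervalIntegrable (fun x : ℝ => p.eval x * ((1 - x) ^ a * (1 + x) ^ b))
      MeasureTheory.volume (-1) 1 :=
  (intervalIntegrable_jacobiWeight ha hb).continuousOn_mul p.continuous.continuousOn

/-- The linear functional `p ↦ ∫ p(x) (1-x)^a (1+x)^b dx` over `[-1, 1]`. -/
noncomputable def jacobiIntegral (a b : ℝ) (ha : -1 < a) (hb : -1 < b) : ℝ[X] →ₗ[ℝ] ℝ where
  toFun p := ∫ x in (-1 : ℝ)..1, p.eval x * ((1 - x) ^ a * (1 + x) ^ b)
  map_add' p q := by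
    rw [← intervalIntegral.integral_add (intervalIntegrable_mul_jacobiWeight ha hb p)
      (intervalIntegrable_mul_jacobiWeight ha hb q)]
    simp only [eval_add, add_mul]
  map_smul' c p := by
    rw [RingHom.id_apply, smul_eq_mul, ← intervalIntegral.integral_const_mul]
    simp only [eval_smul, smul_eq_mul, mul_assoc]

section
variable {a b : ℝ} (ha : -1 < a) (hb : -1 < b)

lemma jacobiIntegral_apply (p : ℝ[X]) : jacobiIntegral a b ha hb p =
    ∫ x in (-1 : ℝ)..1, p.eval x * ((1 - x) ^ a * (1 + x) ^ b) := rfl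

lemma jacobiIntegral_C_mul (c : ℝ) (p : ℝ[X]) :
    jacobiIntegral a b ha hb (C c * p) = c * jacobiIntegral a b ha hb p := by
  rw [← smul_eq_C_mul, map_smul, smul_eq_mul]

lemma jacobiIntegral_nonneg {p : ℝ[X]} (hp : ∀ x ∈ Set.Ioo (-1 : ℝ) 1, 0 ≤ p.eval x) :
    0 ≤ jacobiIntegral a b ha hb p := by
  rw [jacobiIntegral_apply, intervalIntegral.integral_of_le (by norm_num),
    MeasureTheory.integral_Ioc_eq_integral_Ioo]
  refine MeasureTheory.setIntegral_nonneg measurableSet_Ioo fun x hx => ?_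
  have h1 : 0 < 1 - x := by linarith [hx.2]
  have h2 : 0 < 1 + x := by linarith [hx.1]
  exact mul_nonneg (hp x hx) (by positivity)

lemma jacobiIntegral_pos {p : ℝ[X]} (hp : ∀ x ∈ Set.Ioo (-1 : ℝ) 1, 0 ≤ p.eval x) (hp0 : p ≠ 0) :
    0 < jacobiIntegral a b ha hb p := by
  rw [jacobiIntegral_apply, intervalIntegral.integral_pos_iff_support_of_nonneg_ae' ?_
    (intervalIntegrable_mul_jacobiWeight ha hb p)]
  · refine ⟨by norm_num, ?_⟩
    have hsub : Set.Ioo (-1 : ℝ) 1 \ (p.rootSet ℝ) ⊆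
        Function.support (fun x : ℝ => p.eval x * ((1 - x) ^ a * (1 + x) ^ b)) ∩
          Set.Ioc (-1 : ℝ) 1 := by
      rintro x ⟨hx, hxr⟩
      refine ⟨?_, Set.Ioo_subset_Ioc_self hx⟩
      have h1 : 0 < 1 - x := by linarith [hx.2]
      have h2 : 0 < 1 + x := by linarith [hx.1]
      rw [mem_rootSet_of_ne hp0, coe_aeval_eq_eval] at hxr
      exact mul_ne_zero hxr (by positivity)
    refine lt_of_lt_of_le ?_ (MeasureTheory.measure_mono hsub)
    rw [MeasureTheory.measure_sdiff_null ((p.rootSet_finite ℝ).measure_zero _)]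
    simp
  · rw [Set.uIoc_of_le (by norm_num), ← MeasureTheory.restrict_Ioo_eq_restrict_Ioc]
    refine (MeasureTheory.ae_restrict_iff' measurableSet_Ioo).2 (Filter.Eventually.of_forall ?_)
    intro x hx
    have h1 : 0 < 1 - x := by linarith [hx.2]
    have h2 : 0 < 1 + x := by linarith [hx.1]
    exact mul_nonneg (hp x hx) (by positivity)

lemma jacobiIntegral_one_add_X_mul (p : ℝ[X]) (hb' : -1 < b + 1) :
    jacobiIntegral a (b + 1) ha hb' p = jacobiIntegral a b ha hb ((1 + X) * p) := by
  rw [jacobiIntegral_apply, jacobiIntegral_apply]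
  refine intervalIntegral.integral_congr_ae ?_
  refine Filter.Eventually.of_forall fun x hx => ?_
  rw [Set.uIoc_of_le (by norm_num)] at hx
  have h1 : 1 + x ≠ 0 := by linarith [hx.1]
  simp only [eval_mul, eval_add, eval_one, eval_X]
  rw [Real.rpow_add_one h1]
  ring

/-- Integration by parts: the integral of the derivative of `p (1-x)^(a+1) (1+x)^(b+1)` vanishes. -/
lemma jacobiIntegral_integration_by_parts (p : ℝ[X]) :
    jacobiIntegral a b ha hb ((1 - X) * (1 + X) * derivative p) =
      (a + 1) * jacobiIntegral a b ha hb ((1 + X) * p) -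
        (b + 1) * jacobiIntegral a b ha hb ((1 - X) * p) := by
  have hkey : jacobiIntegral a b ha hb ((1 - X) * (1 + X) * derivative p -
      C (a + 1) * ((1 + X) * p) + C (b + 1) * ((1 - X) * p)) = 0 := by
    rw [jacobiIntegral_apply]
    rw [intervalIntegral.integral_eq_sub_of_hasDerivAt_of_le
      (f := fun x : ℝ => p.eval x * ((1 - x) ^ (a + 1) * (1 + x) ^ (b + 1))) (by norm_num) ?_ ?_
      (intervalIntegrable_mul_jacobiWeight ha hb _)]
    · have h1 : a + 1 ≠ 0 := by linarith
      have h2 : b + 1 ≠ 0 := by linarith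
      simp [Real.zero_rpow h1, Real.zero_rpow h2]
    · refine p.continuous.continuousOn.mul (ContinuousOn.mul ?_ ?_)
      · exact ContinuousOn.rpow_const (by fun_prop) fun x _ => Or.inr (by linarith)
      · exact ContinuousOn.rpow_const (by fun_prop) fun x _ => Or.inr (by linarith)
    · intro x hx
      have h1 : 1 - x ≠ 0 := by linarith [hx.2]
      have h2 : 1 + x ≠ 0 := by linarith [hx.1]
      have d1 : HasDerivAt (fun x : ℝ => (1 - x) ^ (a + 1)) (-1 * (a + 1) * (1 - x) ^ (a + 1 - 1)) x :=
        ((hasDerivAt_id x).const_sub 1).rpow_const (Or.inl h1)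
      have d2 : HasDerivAt (fun x : ℝ => (1 + x) ^ (b + 1)) (1 * (b + 1) * (1 + x) ^ (b + 1 - 1)) x :=
        ((hasDerivAt_id x).const_add 1).rpow_const (Or.inl h2)
      refine ((p.hasDerivAt x).mul (d1.mul d2)).congr_deriv ?_
      simp only [Pi.mul_apply, add_sub_cancel_right, Real.rpow_add_one h1, Real.rpow_add_one h2, eval_add,
        eval_sub, eval_mul, eval_one, eval_X, eval_C]
      ring
  rw [map_add, map_sub, jacobiIntegral_C_mul, jacobiIntegral_C_mul] at hkey
  linarith

end

/-! ### Taylor coefficients of Jacobi polynomials at `1` -/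

lemma ascPochhammer_eval_succ_left (k : ℕ) (r : ℝ) :
    (ascPochhammer ℝ (k + 1)).eval r = r * (ascPochhammer ℝ k).eval (r + 1) := by
  rw [ascPochhammer_succ_left]
  simp

lemma ascPochhammer_eval_neg_natCast (n k : ℕ) :
    (ascPochhammer ℝ k).eval (-(n : ℝ)) = (-1) ^ k * (k.factorial * n.choose k) := by
  rw [ascPochhammer_eval_neg_eq_descPochhammer, descPochhammer_eval_eq_descFactorial,
    Nat.descFactorial_eq_factorial_mul_choose]
  push_cast
  rfl

/-- The value at `1` of the `j`-th derivative of `P_n^{(α,β)}`. -/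
noncomputable def jacobiTaylor (n : ℕ) (α β : ℝ) (j : ℕ) : ℝ :=
  (ascPochhammer ℝ n).eval (α + 1) / n.factorial *
    ((ascPochhammer ℝ j).eval (-(n : ℝ)) * (ascPochhammer ℝ j).eval ((n : ℝ) + α + β + 1) /
      (ascPochhammer ℝ j).eval (α + 1)) * (-1 / 2) ^ j

lemma jacobiPoly_eq_sum (n : ℕ) (α β : ℝ) : jacobiPoly n α β =
    ∑ k ∈ Finset.range (n + 1), C (jacobiTaylor n α β k / k.factorial) * (X - C 1) ^ k := by
  rw [jacobiPoly, Finset.mul_sum]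
  refine Finset.sum_congr rfl fun k _ => ?_
  have : (C (1 / 2 : ℝ) * (1 - X)) ^ k = C ((-1 / 2 : ℝ) ^ k) * (X - C 1) ^ k := by
    rw [C_pow, ← mul_pow]
    congr 1
    rw [neg_div, C_neg, C_1]
    ring
  rw [this, ← mul_assoc, ← mul_assoc, ← C_mul, ← C_mul]
  congr 2
  rw [jacobiTaylor, mul_div_mul_comm, div_eq_mul_inv _ (k.factorial : ℝ)]
  ring

lemma jacobiTaylor_eq_zero {n j : ℕ} (α β : ℝ) (h : n < j) : jacobiTaylor n α β j = 0 := by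
  rw [jacobiTaylor, ascPochhammer_eval_neg_coe_nat_of_lt h]
  simp

lemma eval_one_iterate_derivative_jacobiPoly (n : ℕ) (α β : ℝ) (j : ℕ) :
    (derivative^[j] (jacobiPoly n α β)).eval 1 = jacobiTaylor n α β j := by
  rw [jacobiPoly_eq_sum, iterate_derivative_sum, eval_finsetSum]
  have hterm : ∀ k, (derivative^[j] (C (jacobiTaylor n α β k / k.factorial) *
      (X - C 1) ^ k)).eval 1 = if k = j then jacobiTaylor n α β j else 0 := by
    intro k
    rw [iterate_derivative_C_mul, iterate_derivative_X_sub_pow]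
    split_ifs with h
    · subst h
      simp [Nat.descFactorial_self]
      field_simp
    · rcases lt_or_gt_of_ne h with h | h
      · simp [Nat.descFactorial_eq_zero_iff_lt.2 h]
      · have : k - j ≠ 0 := by omega
        simp [this]
  rw [Finset.sum_congr rfl fun k _ => hterm k, Finset.sum_ite_eq']
  split_ifs with h
  · rfl
  · rw [jacobiTaylor_eq_zero]
    simpa using h

lemma jacobiPhi_eq_sum (n : ℕ) (α β : ℝ) : jacobiPhi n α β =
    ∑ k ∈ Finset.range (n / 2 + 1), C (jacobiTaylor n α β (2 * k)) * X ^ k := by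
  simp only [jacobiPhi, eval_one_iterate_derivative_jacobiPoly]

lemma jacobiPhi_coeff (n : ℕ) (α β : ℝ) (k : ℕ) :
    (jacobiPhi n α β).coeff k = jacobiTaylor n α β (2 * k) := by
  rw [jacobiPhi_eq_sum, finsetSum_coeff]
  simp only [coeff_C_mul_X_pow]
  rw [Finset.sum_ite_eq]
  split_ifs with h
  · rfl
  · rw [jacobiTaylor_eq_zero]
    simp at h
    omega

lemma jacobiTaylor_pos {n j : ℕ} {α β : ℝ} (hα : -1 < α) (hn : 0 < (n : ℝ) + α + β + 1)
    (hj : j ≤ n) : 0 < jacobiTaylor n α β j := by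
  have h1 := ascPochhammer_pos n (α + 1) (by linarith)
  have h2 := ascPochhammer_pos j (α + 1) (by linarith)
  have h3 := ascPochhammer_pos j _ hn
  have h4 : (0 : ℝ) < n.choose j := by exact_mod_cast Nat.choose_pos hj
  have h5 : (-1 : ℝ) ^ j * (-1 / 2) ^ j = (1 / 2) ^ j := by
    rw [← mul_pow]
    norm_num
  have e : jacobiTaylor n α β j = (ascPochhammer ℝ n).eval (α + 1) / n.factorial *
      ((j.factorial * n.choose j) * (ascPochhammer ℝ j).eval ((n : ℝ) + α + β + 1) /
        (ascPochhammer ℝ j).eval (α + 1)) * (1 / 2) ^ j := by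
    rw [jacobiTaylor, ascPochhammer_eval_neg_natCast, ← h5]
    ring
  rw [e]
  positivity

/-- The Taylor form of `(P_{n+1}^{(α,β)})' = (n + α + β + 2) / 2 * P_n^{(α+1,β+1)}`. -/
lemma jacobiTaylor_succ_succ (n j : ℕ) {α β : ℝ} (hα : -1 < α) :
    jacobiTaylor (n + 1) α β (j + 1) =
      (n + α + β + 2) / 2 * jacobiTaylor n (α + 1) (β + 1) j := by
  have h0 : α + 1 ≠ 0 := by linarith
  have h2 := (ascPochhammer_pos j (α + 1 + 1) (by linarith)).ne'
  rw [jacobiTaylor, jacobiTaylor, ascPochhammer_eval_succ_left, ascPochhammer_eval_succ_left,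
    ascPochhammer_eval_succ_left, ascPochhammer_eval_succ_left, Nat.factorial_succ]
  have e1 : -((n + 1 : ℕ) : ℝ) + 1 = -(n : ℝ) := by push_cast; ring
  have e2 : ((n + 1 : ℕ) : ℝ) + α + β + 1 + 1 = n + (α + 1) + (β + 1) + 1 := by push_cast; ring
  rw [e1, e2]
  push_cast
  field_simp
  ring

/-- The Taylor form of the expression of `P_n^{(α,β)}` through `P_n^{(α,β-1)}` and its Euler
derivative. -/
lemma jacobiTaylor_eq_mul_sub_one (n j : ℕ) {α β : ℝ} (hn : 0 < (n : ℝ) + α + β) :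
    jacobiTaylor n α β j = (n + α + β + j) / (n + α + β) * jacobiTaylor n α (β - 1) j := by
  have e1 : (n : ℝ) + α + (β - 1) + 1 = n + α + β := by ring
  have h := ascPochhammer_succ_eval j ((n : ℝ) + α + β)
  rw [ascPochhammer_eval_succ_left] at h
  have h' : (ascPochhammer ℝ j).eval ((n : ℝ) + α + β + 1) =
      (n + α + β + j) / (n + α + β) * (ascPochhammer ℝ j).eval ((n : ℝ) + α + β) := by
    field_simp
    linarith
  rw [jacobiTaylor, jacobiTaylor, e1, h']
  ring

lemma jacobiTaylor_eq_mul_succ_sub_one (n j : ℕ) {α β : ℝ} (hα : -1 < α) :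
    jacobiTaylor n α β j =
      ((n + 1 : ℝ) - j) / (n + 1 + α) * jacobiTaylor (n + 1) α (β - 1) j := by
  have e1 : ((n + 1 : ℕ) : ℝ) + α + (β - 1) + 1 = n + α + β + 1 := by push_cast; ring
  have h := ascPochhammer_succ_eval j (-((n + 1 : ℕ) : ℝ))
  rw [ascPochhammer_eval_succ_left] at h
  have e2 : -((n + 1 : ℕ) : ℝ) + 1 = -(n : ℝ) := by push_cast; ring
  rw [e2] at h
  have hn : (n : ℝ) + 1 ≠ 0 := by positivity
  have h' : (ascPochhammer ℝ j).eval (-(n : ℝ)) =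
      ((n + 1 : ℝ) - j) / (n + 1) * (ascPochhammer ℝ j).eval (-((n + 1 : ℕ) : ℝ)) := by
    field_simp
    push_cast at h ⊢
    linarith
  have hα' : (n : ℝ) + 1 + α ≠ 0 := by
    have : (0 : ℝ) ≤ n := n.cast_nonneg
    linarith
  rw [jacobiTaylor, jacobiTaylor, e1, h', ascPochhammer_succ_eval, Nat.factorial_succ]
  push_cast
  rw [show α + 1 + (n : ℝ) = n + 1 + α by ring]
  field_simp

/-! ### Orthogonality -/

/-- The Chu–Vandermonde identity, with denominators cleared. -/
lemma sum_choose_mul_ascPochhammer (n : ℕ) (B D : ℝ) :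
    ∑ k ∈ Finset.range (n + 1), (-1) ^ k * (n.choose k : ℝ) * (ascPochhammer ℝ k).eval B *
      (ascPochhammer ℝ (n - k)).eval (D + k) = (ascPochhammer ℝ n).eval (D - B) := by
  induction n generalizing D with
  | zero => simp
  | succ n ih =>
    have hsplit : ∑ k ∈ Finset.range (n + 1 + 1), (-1) ^ k * ((n + 1).choose k : ℝ) *
          (ascPochhammer ℝ k).eval B * (ascPochhammer ℝ (n + 1 - k)).eval (D + k) =
        ∑ k ∈ Finset.range (n + 1), ((-1) ^ k * (n.choose k : ℝ) *
          (ascPochhammer ℝ k).eval B * (ascPochhammer ℝ (n + 1 - k)).eval (D + k) +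
          (-1) ^ (k + 1) * (n.choose k : ℝ) * (ascPochhammer ℝ (k + 1)).eval B *
            (ascPochhammer ℝ (n - k)).eval (D + k + 1)) := by
      rw [Finset.sum_add_distrib, Finset.sum_range_succ' _ (n + 1),
        Finset.sum_range_succ' (fun k => (-1) ^ k * (n.choose k : ℝ) *
          (ascPochhammer ℝ k).eval B * (ascPochhammer ℝ (n + 1 - k)).eval (D + k)) n]
      have h1 : ∀ k ∈ Finset.range (n + 1), (-1) ^ (k + 1) * ((n + 1).choose (k + 1) : ℝ) *
          (ascPochhammer ℝ (k + 1)).eval B *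
            (ascPochhammer ℝ (n + 1 - (k + 1))).eval (D + (k + 1 : ℕ)) =
          (-1) ^ (k + 1) * (n.choose (k + 1) : ℝ) * (ascPochhammer ℝ (k + 1)).eval B *
            (ascPochhammer ℝ (n + 1 - (k + 1))).eval (D + (k + 1 : ℕ)) +
          (-1) ^ (k + 1) * (n.choose k : ℝ) * (ascPochhammer ℝ (k + 1)).eval B *
            (ascPochhammer ℝ (n - k)).eval (D + k + 1) := by
        intro k _
        rw [Nat.choose_succ_succ, Nat.succ_sub_succ]
        push_cast
        rw [← add_assoc]
        ring
      rw [Finset.sum_congr rfl h1, Finset.sum_add_distrib, Finset.sum_range_succ _ n]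
      simp
      ring
    rw [hsplit, ascPochhammer_eval_succ_left, show D - B + 1 = D + 1 - B by ring, ← ih,
      Finset.mul_sum]
    refine Finset.sum_congr rfl fun k hk => ?_
    have hk' : n + 1 - k = (n - k) + 1 := by
      simp at hk
      omega
    rw [hk', ascPochhammer_eval_succ_left, ascPochhammer_succ_eval,
      show D + 1 + (k : ℝ) = D + k + 1 by ring]
    ring

section
variable {a b : ℝ} (ha : -1 < a) (hb : -1 < b)

lemma jacobiIntegral_one_sub_X_pow_mul (k m : ℕ) :
    (ascPochhammer ℝ k).eval (a + b + m + 2) *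
        jacobiIntegral a b ha hb ((1 - X) ^ k * (1 + X) ^ m) =
      2 ^ k * (ascPochhammer ℝ k).eval (a + 1) * jacobiIntegral a b ha hb ((1 + X) ^ m) := by
  induction k with
  | zero => simp
  | succ k ih =>
    have hd1 : (1 - X) * derivative ((1 - X : ℝ[X]) ^ k) = -C (k : ℝ) * (1 - X) ^ k := by
      cases k with
      | zero => simp
      | succ k =>
        simp [derivative_pow]
        ring
    have hd2 : (1 + X) * derivative ((1 + X : ℝ[X]) ^ m) = C (m : ℝ) * (1 + X) ^ m := by
      cases m with
      | zero => simp
      | succ m =>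
        simp [derivative_pow]
        ring
    have hibp := jacobiIntegral_integration_by_parts ha hb ((1 - X) ^ k * (1 + X) ^ m)
    have e1 : (1 - X) * (1 + X) * derivative ((1 - X : ℝ[X]) ^ k * (1 + X) ^ m) =
        C (m + k : ℝ) * ((1 - X) ^ (k + 1) * (1 + X) ^ m) -
          C (2 * k : ℝ) * ((1 - X) ^ k * (1 + X) ^ m) := by
      rw [derivative_mul]
      simp only [C_add, C_mul]
      rw [show (C 2 : ℝ[X]) = 2 from rfl]
      linear_combination (1 + X) * (1 + X) ^ m * hd1 + (1 - X) * (1 - X) ^ k * hd2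
    have e2 : (1 + X) * ((1 - X : ℝ[X]) ^ k * (1 + X) ^ m) =
        C 2 * ((1 - X) ^ k * (1 + X) ^ m) - (1 - X) ^ (k + 1) * (1 + X) ^ m := by
      rw [show (C 2 : ℝ[X]) = 2 from rfl]
      ring
    have e3 : (1 - X) * ((1 - X : ℝ[X]) ^ k * (1 + X) ^ m) =
        (1 - X) ^ (k + 1) * (1 + X) ^ m := by ring
    rw [e1, e2, e3, map_sub, map_sub, jacobiIntegral_C_mul, jacobiIntegral_C_mul,
      jacobiIntegral_C_mul] at hibp
    rw [ascPochhammer_succ_eval, ascPochhammer_succ_eval]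
    linear_combination 2 * (a + 1 + k) * ih + (ascPochhammer ℝ k).eval (a + b + m + 2) * hibp

/-- The moments of `P_n^{(a,b-1)}` for the weight with exponents `a` and `b`. The factor
`(m + 2 - n)_n` vanishes for `m + 2 ≤ n` and is positive otherwise. -/
lemma jacobiIntegral_jacobiPoly_mul (n m : ℕ) :
    jacobiIntegral a b ha hb (jacobiPoly n a (b - 1) * (1 + X) ^ m) =
      (ascPochhammer ℝ n).eval (a + 1) / n.factorial *
        ((ascPochhammer ℝ n).eval ((m : ℝ) + 2 - n) / (ascPochhammer ℝ n).eval (a + b + m + 2)) *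
        jacobiIntegral a b ha hb ((1 + X) ^ m) := by
  set J := jacobiIntegral a b ha hb ((1 + X) ^ m) with hJ
  have hm : (0 : ℝ) ≤ m := m.cast_nonneg
  have hD : 0 < a + b + m + 2 := by linarith
  have hV := sum_choose_mul_ascPochhammer n ((n : ℝ) + a + b) (a + b + m + 2)
  rw [show a + b + (m : ℝ) + 2 - (n + a + b) = m + 2 - n by ring] at hV
  rw [← hV, jacobiPoly, mul_assoc, jacobiIntegral_C_mul, Finset.sum_mul, map_sum, mul_assoc,
    Finset.sum_div, Finset.sum_mul]
  congr 1
  refine Finset.sum_congr rfl fun k hk => ?_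
  have hk' : k ≤ n := by
    simp at hk
    omega
  have hmom := jacobiIntegral_one_sub_X_pow_mul ha hb k m
  have hp1 := (ascPochhammer_pos k _ hD).ne'
  have hp2 := (ascPochhammer_pos n _ hD).ne'
  have hp3 := (ascPochhammer_pos k (a + 1) (by linarith)).ne'
  have hprod : (ascPochhammer ℝ n).eval (a + b + m + 2) = (ascPochhammer ℝ k).eval (a + b + m + 2) *
      (ascPochhammer ℝ (n - k)).eval (a + b + m + 2 + k) := by
    have := ascPochhammer_mul (S := ℝ) k (n - k)
    rw [Nat.add_sub_cancel' hk'] at this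
    rw [← this]
    simp
  rw [mul_assoc, jacobiIntegral_C_mul, mul_pow, mul_assoc, ← C_pow, jacobiIntegral_C_mul,
    ascPochhammer_eval_neg_natCast, show (n : ℝ) + a + (b - 1) + 1 = n + a + b by ring]
  have hmom' : jacobiIntegral a b ha hb ((1 - X) ^ k * (1 + X) ^ m) =
      2 ^ k * (ascPochhammer ℝ k).eval (a + 1) * J / (ascPochhammer ℝ k).eval (a + b + m + 2) := by
    field_simp
    linarith
  rw [hmom', hprod]
  rw [hprod] at hp2
  have hp4 := right_ne_zero_of_mul hp2
  have hf : (k.factorial : ℝ) ≠ 0 := by positivity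
  rw [one_div, inv_pow]
  field_simp

lemma jacobiIntegral_one_add_X_pow_pos (m : ℕ) :
    0 < jacobiIntegral a b ha hb ((1 + X) ^ m) := by
  refine jacobiIntegral_pos ha hb (fun x hx => ?_) (pow_ne_zero _ ?_)
  · have : 0 < 1 + x := by linarith [hx.1]
    simp only [eval_pow, eval_add, eval_one, eval_X]
    positivity
  · rw [add_comm]
    exact (monic_X_add_C (1 : ℝ)).ne_zero

lemma jacobiIntegral_jacobiPoly_mul_eq_zero {n m : ℕ} (h : m + 2 ≤ n) :
    jacobiIntegral a b ha hb (jacobiPoly n a (b - 1) * (1 + X) ^ m) = 0 := by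
  obtain ⟨l, rfl⟩ := Nat.exists_eq_add_of_le h
  rw [jacobiIntegral_jacobiPoly_mul]
  have : (m : ℝ) + 2 - (m + 2 + l : ℕ) = -(l : ℝ) := by push_cast; ring
  rw [this, ascPochhammer_eval_neg_coe_nat_of_lt (by omega)]
  simp

lemma jacobiIntegral_jacobiPoly_mul_pos {n m : ℕ} (h : n < m + 2) :
    0 < jacobiIntegral a b ha hb (jacobiPoly n a (b - 1) * (1 + X) ^ m) := by
  rw [jacobiIntegral_jacobiPoly_mul]
  have hm : (0 : ℝ) ≤ m := m.cast_nonneg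
  have h1 := ascPochhammer_pos n (a + 1) (by linarith)
  have h2 := ascPochhammer_pos n (a + b + m + 2) (by linarith)
  have h' : (n : ℝ) < m + 2 := by exact_mod_cast h
  have h3 := ascPochhammer_pos n ((m : ℝ) + 2 - n) (by linarith)
  have h4 := jacobiIntegral_one_add_X_pow_pos ha hb m
  positivity

end

/-! ### Stability of the generating polynomial of the derivatives at `1` -/

section
variable {a b : ℝ} (ha : -1 < a) (hb : -1 < b)

/-- If all moments of `P` against powers `(1+x)^m` with `m < N` vanish, then `P` is orthogonal to all
polynomials of degree less than `N`. -/
lemma jacobiIntegral_mul_eq_zero_of_degree_lt {P g : ℝ[X]} {N : ℕ}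
    (hP : ∀ m < N, jacobiIntegral a b ha hb (P * (1 + X) ^ m) = 0) (hg : g.degree < N) :
    jacobiIntegral a b ha hb (P * g) = 0 := by
  have hexp := sum_taylor_eq g (-1)
  rw [← hexp, Polynomial.sum, Finset.mul_sum, map_sum]
  refine Finset.sum_eq_zero fun i hi => ?_
  have hi' : i < N := by
    have h1 := le_degree_of_mem_supp i hi
    rw [degree_taylor] at h1
    exact_mod_cast h1.trans_lt hg
  have e : (X - C (-1 : ℝ)) = 1 + X := by
    rw [C_neg, C_1]
    ring
  rw [e, mul_left_comm, jacobiIntegral_C_mul, hP i hi', mul_zero]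

lemma jacobiIntegral_mul_of_natDegree_le {P g : ℝ[X]} {N : ℕ}
    (hP : ∀ m < N, jacobiIntegral a b ha hb (P * (1 + X) ^ m) = 0) (hg : g.natDegree ≤ N) :
    jacobiIntegral a b ha hb (P * g) =
      g.coeff N * jacobiIntegral a b ha hb (P * (1 + X) ^ N) := by
  have h : jacobiIntegral a b ha hb (P * (g - C (g.coeff N) * (1 + X) ^ N)) = 0 := by
    refine jacobiIntegral_mul_eq_zero_of_degree_lt ha hb hP ?_
    rw [degree_lt_iff_coeff_zero]
    intro m hm
    rw [coeff_sub, coeff_C_mul, coeff_one_add_X_pow]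
    rcases hm.eq_or_lt with rfl | hm
    · simp
    · rw [coeff_eq_zero_of_natDegree_lt (hg.trans_lt hm), Nat.choose_eq_zero_of_lt hm]
      simp
  rw [mul_sub, map_sub, mul_left_comm, jacobiIntegral_C_mul] at h
  linarith

lemma jacobiIntegral_one_add_X_mul_mul_derivative_nonpos (ha' : a ≤ 0) (q : ℝ[X]) :
    jacobiIntegral a b ha hb ((1 + X) * (((1 - X) * q) * derivative ((1 - X) * q))) ≤ 0 := by
  have hibp := jacobiIntegral_integration_by_parts ha hb ((1 - X) * q ^ 2)
  have e1 : C 2 * ((1 + X) * (((1 - X) * q) * derivative ((1 - X) * q))) =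
      (1 - X) * (1 + X) * derivative ((1 - X) * q ^ 2) - (1 + X) * ((1 - X) * q ^ 2) := by
    rw [show (C 2 : ℝ[X]) = 2 from rfl]
    simp [derivative_mul, sq]
    ring
  have h1 : 0 ≤ jacobiIntegral a b ha hb ((1 + X) * ((1 - X) * q ^ 2)) := by
    refine jacobiIntegral_nonneg ha hb fun x hx => ?_
    have h1 : 0 < 1 - x := by linarith [hx.2]
    have h2 : 0 < 1 + x := by linarith [hx.1]
    simp only [eval_mul, eval_add, eval_sub, eval_one, eval_X, eval_pow]
    positivity
  have h2 : 0 ≤ jacobiIntegral a b ha hb ((1 - X) * ((1 - X) * q ^ 2)) := by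
    refine jacobiIntegral_nonneg ha hb fun x hx => ?_
    have h1 : 0 < 1 - x := by linarith [hx.2]
    simp only [eval_mul, eval_sub, eval_one, eval_X, eval_pow]
    positivity
  have e2 := congrArg (jacobiIntegral a b ha hb) e1
  rw [jacobiIntegral_C_mul, map_sub, hibp] at e2
  nlinarith

end

/-- For `f = (1 - x) q` the pairing of `f'` with `q = f / (1 - x)` is negative. Integration by parts
needs the weight with second exponent `c`, so the second exponent `c + 1` of the pairing itself must
be positive. -/
lemma jacobiIntegral_derivative_one_sub_X_mul {a c : ℝ} (ha : -1 < a) (hc : -1 < c)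
    (hb : -1 < c + 1) (ha' : a < 1) (q : ℝ[X]) :
    jacobiIntegral a (c + 1) ha hb (derivative ((1 - X) * q) * q) ≤ 0 ∧
      (q ≠ 0 → jacobiIntegral a (c + 1) ha hb (derivative ((1 - X) * q) * q) < 0) := by
  have hibp := jacobiIntegral_integration_by_parts ha hc (q ^ 2)
  have e1 : C 2 * ((1 + X) * (derivative ((1 - X) * q) * q)) =
      (1 - X) * (1 + X) * derivative (q ^ 2) - C 2 * ((1 + X) * q ^ 2) := by
    rw [show (C 2 : ℝ[X]) = 2 from rfl]
    simp [derivative_mul, sq]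
    ring
  have e2 := congrArg (jacobiIntegral a c ha hc) e1
  rw [jacobiIntegral_C_mul, map_sub, hibp, jacobiIntegral_C_mul] at e2
  rw [jacobiIntegral_one_add_X_mul ha hc]
  have hn1 : ∀ x ∈ Set.Ioo (-1 : ℝ) 1, 0 ≤ ((1 + X) * q ^ 2).eval x := by
    intro x hx
    have h2 : 0 < 1 + x := by linarith [hx.1]
    simp only [eval_mul, eval_add, eval_one, eval_X, eval_pow]
    positivity
  have h1 := jacobiIntegral_nonneg ha hc hn1
  have h2 : 0 ≤ jacobiIntegral a c ha hc ((1 - X) * q ^ 2) := by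
    refine jacobiIntegral_nonneg ha hc fun x hx => ?_
    have h1 : 0 < 1 - x := by linarith [hx.2]
    simp only [eval_mul, eval_sub, eval_one, eval_X, eval_pow]
    positivity
  refine ⟨by nlinarith, fun hq => ?_⟩
  have h3 : 0 < jacobiIntegral a c ha hc ((1 + X) * q ^ 2) := by
    refine jacobiIntegral_pos ha hc hn1 (mul_ne_zero ?_ (pow_ne_zero _ hq))
    rw [add_comm]
    exact (monic_X_add_C (1 : ℝ)).ne_zero
  nlinarith

/-- For a real polynomial `P` and a complex number `z`, the real and imaginary parts `u`, `v` of
`f = ∑_k z^k P^{(k)}`, the polynomial solution of `f - z f' = P`. -/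
lemma exists_resolvent (P : ℝ[X]) (z : ℂ) :
    ∃ u v : ℝ[X], u.natDegree ≤ P.natDegree ∧ v.natDegree ≤ P.natDegree ∧
      u - (C z.re * derivative u - C z.im * derivative v) = P ∧
      v - (C z.re * derivative v + C z.im * derivative u) = 0 ∧
      ((u.eval 1 : ℝ) + (v.eval 1 : ℝ) * Complex.I : ℂ) =
        ∑ k ∈ Finset.range (P.natDegree + 1), ((derivative^[k] P).eval 1 : ℝ) * z ^ k := by
  set n := P.natDegree with hn
  have hdeg : ∀ c : ℕ → ℝ,
      (∑ k ∈ Finset.range (n + 1), C (c k) * derivative^[k] P).natDegree ≤ n := by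
    intro c
    refine natDegree_sum_le_of_forall_le _ _ fun k _ => ?_
    refine (natDegree_C_mul_le _ _).trans ?_
    exact (natDegree_iterate_derivative P k).trans (Nat.sub_le _ _)
  have hder : ∀ c : ℕ → ℝ, derivative (∑ k ∈ Finset.range (n + 1), C (c k) * derivative^[k] P) =
      ∑ k ∈ Finset.range n, C (c k) * derivative^[k + 1] P := by
    intro c
    rw [derivative_sum, Finset.sum_range_succ]
    have h0 : derivative^[n + 1] P = 0 := iterate_derivative_eq_zero (by omega)
    rw [derivative_C_mul, ← Function.iterate_succ_apply' derivative n P, h0, mul_zero, add_zero]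
    refine Finset.sum_congr rfl fun k _ => ?_
    rw [derivative_C_mul, ← Function.iterate_succ_apply' derivative k P]
  refine ⟨∑ k ∈ Finset.range (n + 1), C ((z ^ k).re) * derivative^[k] P,
    ∑ k ∈ Finset.range (n + 1), C ((z ^ k).im) * derivative^[k] P, hdeg _, hdeg _, ?_, ?_, ?_⟩
  · rw [hder, hder, Finset.sum_range_succ', Finset.mul_sum, Finset.mul_sum,
      ← Finset.sum_sub_distrib, add_sub_right_comm, ← Finset.sum_sub_distrib]
    rw [Finset.sum_eq_zero]
    · simp
    · intro k _
      rw [pow_succ, Complex.mul_re]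
      simp only [C_sub, C_mul]
      ring
  · rw [hder, hder, Finset.sum_range_succ', Finset.mul_sum, Finset.mul_sum,
      ← Finset.sum_add_distrib, add_sub_right_comm, ← Finset.sum_sub_distrib]
    rw [Finset.sum_eq_zero]
    · simp
    · intro k _
      rw [pow_succ, Complex.mul_im]
      simp only [C_add, C_mul]
      ring
  · simp only [eval_finsetSum, eval_mul, eval_C, Complex.ofReal_sum, Complex.ofReal_mul]
    rw [Finset.sum_mul, ← Finset.sum_add_distrib]
    refine Finset.sum_congr rfl fun k _ => ?_
    conv_rhs => rw [← Complex.re_add_im (z ^ k)]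
    ring

lemma exists_eq_one_sub_X_mul {u : ℝ[X]} (hu : u.eval 1 = 0) : ∃ q, u = (1 - X) * q := by
  obtain ⟨q, hq⟩ := dvd_iff_isRoot.2 (show u.IsRoot 1 from hu)
  refine ⟨-q, ?_⟩
  rw [hq, C_1]
  ring

lemma degree_lt_of_natDegree_one_sub_X_mul_le {q : ℝ[X]} {N : ℕ}
    (h : ((1 - X) * q).natDegree ≤ N) : q.degree < N := by
  by_cases hq : q = 0
  · rw [hq, degree_zero]
    exact WithBot.bot_lt_coe N
  · have h1 : (1 - X : ℝ[X]) = -(X - C 1) := by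
      rw [C_1]
      ring
    rw [h1, neg_mul, natDegree_neg, natDegree_mul (X_sub_C_ne_zero 1) hq, natDegree_X_sub_C] at h
    rw [degree_eq_natDegree hq]
    exact_mod_cast (by omega : q.natDegree < N)

section
variable {P u v : ℝ[X]} {N : ℕ} {x y : ℝ}

/-- The imaginary part of the resolvent has smaller degree than `P`, because `P` is real. -/
lemma resolvent_im_natDegree_le (hu : u.natDegree ≤ N + 1) (hv : v.natDegree ≤ N + 1)
    (him : v - (C x * derivative v + C y * derivative u) = 0) : v.natDegree ≤ N := by
  rw [sub_eq_zero.1 him]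
  refine natDegree_add_le_of_degree_le ((natDegree_C_mul_le _ _).trans ?_)
    ((natDegree_C_mul_le _ _).trans ?_)
  · exact (natDegree_derivative_le _).trans (by omega)
  · exact (natDegree_derivative_le _).trans (by omega)

lemma resolvent_re_coeff (hu : u.natDegree ≤ N + 1) (hv : v.natDegree ≤ N + 1)
    (hre : u - (C x * derivative u - C y * derivative v) = P) :
    u.coeff (N + 1) = P.coeff (N + 1) := by
  rw [← hre, coeff_sub, coeff_sub, coeff_C_mul, coeff_C_mul, coeff_derivative, coeff_derivative,
    coeff_eq_zero_of_natDegree_lt (by omega : u.natDegree < N + 1 + 1),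
    coeff_eq_zero_of_natDegree_lt (by omega : v.natDegree < N + 1 + 1)]
  ring

/-- Pairing `f - z f' = P` with the conjugate of `f / (1 - x)`, where `f = u + i v` vanishes at `1`
and `z = x + i y`. The top coefficient of `f / (1 - x)` contributes through the first non-vanishing
moment of `P`, with a favourable sign. -/
lemma re_neg_of_resolvent_root {a c : ℝ} (ha : -1 < a) (ha' : a < 1) (hc : -1 < c)
    (hb : -1 < c + 1)
    (hP : ∀ m < N, jacobiIntegral a (c + 1) ha hb (P * (1 + X) ^ m) = 0)
    (hN : 0 < jacobiIntegral a (c + 1) ha hb (P * (1 + X) ^ N))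
    (hlead : 0 < P.coeff (N + 1)) (hP1 : P.eval 1 ≠ 0)
    (hu : u.natDegree ≤ N + 1) (hv : v.natDegree ≤ N + 1)
    (hre : u - (C x * derivative u - C y * derivative v) = P)
    (him : v - (C x * derivative v + C y * derivative u) = 0)
    (hu1 : u.eval 1 = 0) (hv1 : v.eval 1 = 0) : x < 0 := by
  by_contra! hx
  have hr : 0 < x ^ 2 + y ^ 2 := by
    by_contra! h
    have hx0 : x = 0 := by nlinarith
    have hy0 : y = 0 := by nlinarith
    apply hP1
    rw [← hre, hx0, hy0]
    simp [hu1]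
  have hv' := resolvent_im_natDegree_le hu hv him
  have hcoeff := resolvent_re_coeff hu hv hre
  obtain ⟨q, rfl⟩ := exists_eq_one_sub_X_mul hu1
  obtain ⟨w, rfl⟩ := exists_eq_one_sub_X_mul hv1
  have hq := degree_lt_of_natDegree_one_sub_X_mul_le hu
  have hw := degree_lt_of_natDegree_one_sub_X_mul_le hv'
  have hqN : q.natDegree ≤ N := natDegree_le_of_degree_le (Order.le_of_lt_succ hq)
  have hqc : q.coeff N = -P.coeff (N + 1) := by
    rw [← hcoeff, sub_mul, one_mul, coeff_sub, coeff_X_mul,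
      coeff_eq_zero_of_natDegree_lt (by omega : q.natDegree < N + 1)]
    ring
  have hq0 : q ≠ 0 := by
    rintro rfl
    simp at hqc
    linarith
  have hPq := jacobiIntegral_mul_of_natDegree_le ha hb hP hqN
  have hPw := jacobiIntegral_mul_eq_zero_of_degree_lt ha hb hP hw
  rw [hqc] at hPq
  have h1 := (jacobiIntegral_derivative_one_sub_X_mul ha hc hb ha' q).2 hq0
  have h2 := (jacobiIntegral_derivative_one_sub_X_mul ha hc hb ha' w).1
  have h3 : ∀ p : ℝ[X], 0 ≤ jacobiIntegral a (c + 1) ha hb ((1 - X) * p ^ 2) := by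
    intro p
    refine jacobiIntegral_nonneg ha hb fun t ht => ?_
    have h1 : 0 < 1 - t := by linarith [ht.2]
    simp only [eval_mul, eval_sub, eval_one, eval_X, eval_pow]
    positivity
  obtain ⟨r, hr_def⟩ : ∃ r, r = x ^ 2 + y ^ 2 := ⟨_, rfl⟩
  have hCr : (C r : ℝ[X]) = C x ^ 2 + C y ^ 2 := by rw [hr_def, C_add, C_pow, C_pow]
  rw [← hr_def] at hr
  -- The real part of `(f - z f' - P) * conj z * conj (f / (1 - X)) = 0`.
  have e : C x * ((1 - X) * q ^ 2) + C x * ((1 - X) * w ^ 2) -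
      C r * (derivative ((1 - X) * q) * q) -
      C r * (derivative ((1 - X) * w) * w) =
      C x * (P * q) - C y * (P * w) := by
    rw [hCr]
    linear_combination (C x * q - C y * w) * hre + (C y * q + C x * w) * him
  have e' := congrArg (jacobiIntegral a (c + 1) ha hb) e
  simp only [map_sub, map_add, jacobiIntegral_C_mul] at e'
  rw [hPq, hPw] at e'
  have h4 := mul_nonneg hx (h3 q)
  have h5 := mul_nonneg hx (h3 w)
  have h6 := mul_neg_of_pos_of_neg hr h1
  have h7 := mul_nonneg hr.le (neg_nonneg.2 h2)
  have h8 := mul_nonneg hx (mul_pos hlead hN).le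
  linarith

/-- Pairing `f - z f' = P` with the conjugate of `(1 + x) f'`, where `f = u + i v` vanishes at `1`
and `z = x + i y`. For `a ≤ 0` the weight `(1-x)^a (1+x)^(b+1)` is increasing, which fixes the sign of
the pairing with `f`. -/
lemma re_neg_of_resolvent_root_of_nonpos {a b : ℝ} (ha : -1 < a) (ha' : a ≤ 0) (hb : -1 < b)
    (hN0 : 0 < N) (hPdeg : P.natDegree ≤ N + 1)
    (hP : ∀ m < N, jacobiIntegral a b ha hb (P * (1 + X) ^ m) = 0)
    (hN : 0 < jacobiIntegral a b ha hb (P * (1 + X) ^ N))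
    (hN' : 0 < jacobiIntegral a b ha hb (P * (1 + X) ^ (N + 1)))
    (hlead : 0 < P.coeff (N + 1))
    (hu : u.natDegree ≤ N + 1) (hv : v.natDegree ≤ N + 1)
    (hre : u - (C x * derivative u - C y * derivative v) = P)
    (him : v - (C x * derivative v + C y * derivative u) = 0)
    (hu1 : u.eval 1 = 0) (hv1 : v.eval 1 = 0) : x < 0 := by
  by_contra! hx
  have hv' := resolvent_im_natDegree_le hu hv him
  have hcoeff := resolvent_re_coeff hu hv hre
  obtain ⟨M, rfl⟩ : ∃ M, N = M + 1 := ⟨N - 1, by omega⟩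
  set L := jacobiIntegral a b ha hb with hL
  -- `(1 + X) P'` agrees with `N P + P_{N+1} (1 + X)^{N+1}` up to terms of degree less than `N`.
  have hPP' : L (P * ((1 + X) * derivative P)) =
      (M + 1) * L (P * P) + P.coeff (M + 1 + 1) * L (P * (1 + X) ^ (M + 1 + 1)) := by
    have h := jacobiIntegral_mul_eq_zero_of_degree_lt ha hb hP (g := (1 + X) * derivative P -
      C ((M : ℝ) + 1) * P - C (P.coeff (M + 1 + 1)) * (1 + X) ^ (M + 1 + 1)) (by
        rw [degree_lt_iff_coeff_zero]
        intro m hm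
        obtain ⟨l, rfl⟩ := Nat.exists_eq_add_of_le hm
        have e0 : M + 1 + l = M + l + 1 := by ring
        have hz : ∀ j, M + 1 + 1 < j → P.coeff j = 0 := fun j hj =>
          coeff_eq_zero_of_natDegree_lt (by omega)
        rw [e0, coeff_sub, coeff_sub, add_mul, one_mul, coeff_add, coeff_X_mul, coeff_C_mul,
          coeff_C_mul, coeff_derivative, coeff_derivative, coeff_one_add_X_pow]
        match l with
        | 0 =>
          simp only [add_zero, Nat.choose_succ_self_right]
          push_cast
          ring
        | 1 =>
          rw [hz (M + 1 + 1 + 1) (by omega), Nat.choose_self]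
          push_cast
          ring
        | l + 2 =>
          rw [hz (M + (l + 2) + 1 + 1) (by omega), hz (M + (l + 2) + 1) (by omega),
            Nat.choose_eq_zero_of_lt (by omega)]
          simp)
    rw [mul_sub, mul_sub, map_sub, map_sub, mul_left_comm P (C _) P, mul_left_comm P (C _) (_ ^ _),
      jacobiIntegral_C_mul, jacobiIntegral_C_mul] at h
    linarith
  have hPu'' : L (P * ((1 + X) * derivative (derivative u))) =
      P.coeff (M + 1 + 1) * (M + 1 + 1) * (M + 1) * L (P * (1 + X) ^ (M + 1)) := by
    have hdeg : ((1 + X) * derivative (derivative u)).natDegree ≤ M + 1 := by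
      refine natDegree_mul_le.trans ?_
      have h1 := natDegree_derivative_le (derivative u)
      have h2 := natDegree_derivative_le u
      have h3 : (1 + X : ℝ[X]).natDegree ≤ 1 := by
        rw [add_comm]
        exact (natDegree_X_add_C (1 : ℝ)).le
      omega
    rw [hL, jacobiIntegral_mul_of_natDegree_le ha hb hP hdeg]
    congr 1
    rw [add_mul, one_mul, coeff_add, coeff_X_mul, coeff_derivative, coeff_derivative,
      coeff_derivative, coeff_derivative, hcoeff,
      coeff_eq_zero_of_natDegree_lt (by omega : u.natDegree < M + 1 + 1 + 1)]
    push_cast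
    ring
  have hPv'' : L (P * ((1 + X) * derivative (derivative v))) = 0 := by
    refine jacobiIntegral_mul_eq_zero_of_degree_lt ha hb hP ?_
    rw [degree_lt_iff_coeff_zero]
    intro m hm
    obtain ⟨l, rfl⟩ := Nat.exists_eq_add_of_le' hm
    rw [show l + (M + 1) = l + M + 1 by ring, add_mul, one_mul, coeff_add, coeff_X_mul,
      coeff_derivative, coeff_derivative, coeff_derivative, coeff_derivative,
      coeff_eq_zero_of_natDegree_lt (by omega : v.natDegree < l + M + 1 + 1 + 1),
      coeff_eq_zero_of_natDegree_lt (by omega : v.natDegree < l + M + 1 + 1)]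
    ring
  have hu' : derivative u = derivative P + (C x * derivative (derivative u) -
      C y * derivative (derivative v)) := by
    have h := congrArg derivative hre
    rw [derivative_sub, derivative_sub, derivative_C_mul, derivative_C_mul] at h
    linear_combination h
  have hPu' : L (P * ((1 + X) * derivative u)) = L (P * ((1 + X) * derivative P)) +
      x * L (P * ((1 + X) * derivative (derivative u))) := by
    have e : P * ((1 + X) * derivative u) = P * ((1 + X) * derivative P) +
        C x * (P * ((1 + X) * derivative (derivative u))) -
        C y * (P * ((1 + X) * derivative (derivative v))) := by
      linear_combination P * (1 + X) * hu'
    rw [e, map_sub, map_add, jacobiIntegral_C_mul, jacobiIntegral_C_mul, hPv'', mul_zero, sub_zero]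
  -- The real part of `(f - z f' - P) * (1 + X) * conj f' = 0`.
  have e : (1 + X) * (u * derivative u) + (1 + X) * (v * derivative v) =
      C x * ((1 + X) * derivative u ^ 2) + C x * ((1 + X) * derivative v ^ 2) +
        P * ((1 + X) * derivative u) := by
    linear_combination (1 + X) * derivative u * hre + (1 + X) * derivative v * him
  have e' := congrArg L e
  simp only [map_add, hL, jacobiIntegral_C_mul] at e'
  rw [← hL, hPu', hPP', hPu''] at e'
  obtain ⟨q, rfl⟩ := exists_eq_one_sub_X_mul hu1
  obtain ⟨w, rfl⟩ := exists_eq_one_sub_X_mul hv1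
  have h1 := jacobiIntegral_one_add_X_mul_mul_derivative_nonpos ha hb ha' q
  have h2 := jacobiIntegral_one_add_X_mul_mul_derivative_nonpos ha hb ha' w
  have h3 : ∀ p : ℝ[X], 0 ≤ L ((1 + X) * p ^ 2) := by
    intro p
    refine jacobiIntegral_nonneg ha hb fun t ht => ?_
    have h1 : 0 < 1 + t := by linarith [ht.1]
    simp only [eval_mul, eval_add, eval_one, eval_X, eval_pow]
    positivity
  have h4 : 0 ≤ L (P * P) := by
    refine jacobiIntegral_nonneg ha hb fun t ht => ?_
    simp only [eval_mul]
    exact mul_self_nonneg _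
  have h5 := mul_nonneg hx (h3 (derivative ((1 - X) * q)))
  have h6 := mul_nonneg hx (h3 (derivative ((1 - X) * w)))
  have h7 : 0 ≤ x * (P.coeff (M + 1 + 1) * (M + 1 + 1) * (M + 1) * L (P * (1 + X) ^ (M + 1))) := by
    positivity
  have h8 : 0 < (M + 1) * L (P * P) + P.coeff (M + 1 + 1) * L (P * (1 + X) ^ (M + 1 + 1)) := by
    positivity
  linarith

end

lemma jacobiPoly_natDegree_le (n : ℕ) (α β : ℝ) : (jacobiPoly n α β).natDegree ≤ n := by
  rw [jacobiPoly_eq_sum]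
  refine natDegree_sum_le_of_forall_le _ _ fun k hk => ?_
  refine (natDegree_C_mul_le _ _).trans ?_
  rw [natDegree_pow, natDegree_X_sub_C, mul_one]
  simp at hk
  omega

lemma jacobiPoly_coeff_pos {n : ℕ} {α β : ℝ} (hα : -1 < α) (hn : 0 < (n : ℝ) + α + β + 1) :
    0 < (jacobiPoly n α β).coeff n := by
  have h := eval_one_iterate_derivative_jacobiPoly n α β n
  have hdeg : (derivative^[n] (jacobiPoly n α β)).natDegree ≤ 0 :=
    (natDegree_iterate_derivative _ n).trans (by
      have := jacobiPoly_natDegree_le n α β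
      omega)
  rw [eq_C_of_natDegree_le_zero hdeg, eval_C, coeff_iterate_derivative, zero_add,
    Nat.descFactorial_self, nsmul_eq_mul] at h
  have hpos := jacobiTaylor_pos hα hn le_rfl
  rw [← h] at hpos
  exact pos_of_mul_pos_right hpos (by positivity)

/-- The generating polynomial `∑_k (d^k/dx^k P_n^{(α,β)})(1) z^k`. -/
noncomputable def jacobiGen (n : ℕ) (α β : ℝ) : ℝ[X] :=
  ∑ k ∈ Finset.range (n + 1), C (jacobiTaylor n α β k) * X ^ k

lemma jacobiGen_coeff (n : ℕ) (α β : ℝ) (k : ℕ) :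
    (jacobiGen n α β).coeff k = jacobiTaylor n α β k := by
  rw [jacobiGen, finsetSum_coeff]
  simp only [coeff_C_mul_X_pow]
  rw [Finset.sum_ite_eq]
  split_ifs with h
  · rfl
  · rw [jacobiTaylor_eq_zero]
    simpa using h

/-- The even part of the generating polynomial is `φ_n^{(α,β)}`, and the odd part is a multiple of
`φ_{n-1}^{(α+1,β+1)}`. -/
lemma jacobiGen_eq_even_add_odd (N : ℕ) {α β : ℝ} (hα : -1 < α) :
    jacobiGen (N + 1) α β = (jacobiPhi (N + 1) α β).comp (X ^ 2) +
      X * (C ((N + α + β + 2) / 2) * jacobiPhi N (α + 1) (β + 1)).comp (X ^ 2) := by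
  rw [← expand_eq_comp_X_pow, ← expand_eq_comp_X_pow]
  ext m
  rw [coeff_add, jacobiGen_coeff]
  rcases Nat.even_or_odd' m with ⟨k, rfl | rfl⟩
  · rw [coeff_expand two_pos, if_pos (dvd_mul_right 2 k), Nat.mul_div_cancel_left k two_pos,
      jacobiPhi_coeff]
    cases k with
    | zero => simp
    | succ k =>
      rw [show 2 * (k + 1) = 2 * k + 1 + 1 by ring, coeff_X_mul, coeff_expand two_pos,
        if_neg (by omega), add_zero]
  · rw [coeff_X_mul, coeff_expand two_pos, coeff_expand two_pos, if_neg (by omega),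
      if_pos (dvd_mul_right 2 k), Nat.mul_div_cancel_left k two_pos, coeff_C_mul, jacobiPhi_coeff,
      jacobiTaylor_succ_succ N _ hα, zero_add]

/-- Hurwitz stability of the generating polynomial. The weight used has exponents `α` and `β + 1`, so
that `β` may go down to `-1` in the first case and to `-2` in the second. -/
theorem re_neg_of_aeval_jacobiGen_eq_zero {N : ℕ} {α β : ℝ} (hα : -1 < α)
    (hN : 0 < (N : ℝ) + α + β + 2)
    (h : (α < 1 ∧ -1 < β) ∨ (α ≤ 0 ∧ -2 < β ∧ 0 < N)) {z : ℂ}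
    (hz : aeval z (jacobiGen (N + 1) α β) = 0) : z.re < 0 := by
  have hN' : 0 < ((N + 1 : ℕ) : ℝ) + α + β + 1 := by
    push_cast
    linarith
  have hlead := jacobiPoly_coeff_pos hα hN'
  have hdeg : (jacobiPoly (N + 1) α β).natDegree = N + 1 :=
    natDegree_eq_of_le_of_coeff_ne_zero (jacobiPoly_natDegree_le _ α β) hlead.ne'
  obtain ⟨u, v, hu, hv, hre, him, hroot⟩ := exists_resolvent (jacobiPoly (N + 1) α β) z
  have h0 : aeval z (jacobiGen (N + 1) α β) = ∑ k ∈ Finset.range (N + 1 + 1),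
      (((derivative^[k] (jacobiPoly (N + 1) α β)).eval 1 : ℝ) : ℂ) * z ^ k := by
    rw [jacobiGen, map_sum]
    refine Finset.sum_congr rfl fun k _ => ?_
    rw [eval_one_iterate_derivative_jacobiPoly]
    simp
  rw [hdeg, ← h0, hz] at hroot
  rw [hdeg] at hu hv
  have hu1 : u.eval 1 = 0 := by simpa using congrArg Complex.re hroot
  have hv1 : v.eval 1 = 0 := by simpa using congrArg Complex.im hroot
  have hb : -1 < β + 1 := by
    rcases h with h | h
    · linarith [h.2]
    · linarith [h.2.1]
  have hβ : jacobiPoly (N + 1) α β = jacobiPoly (N + 1) α (β + 1 - 1) := by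
    rw [add_sub_cancel_right]
  have hzero : ∀ m < N,
      jacobiIntegral α (β + 1) hα hb (jacobiPoly (N + 1) α β * (1 + X) ^ m) = 0 := by
    intro m hm
    rw [hβ]
    exact jacobiIntegral_jacobiPoly_mul_eq_zero hα hb (by omega)
  have hpos : ∀ m, N ≤ m →
      0 < jacobiIntegral α (β + 1) hα hb (jacobiPoly (N + 1) α β * (1 + X) ^ m) := by
    intro m hm
    rw [hβ]
    exact jacobiIntegral_jacobiPoly_mul_pos hα hb (by omega)
  rcases h with ⟨hα1, hβ1⟩ | ⟨hα0, -, hN0⟩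
  · have hP1 : (jacobiPoly (N + 1) α β).eval 1 ≠ 0 := by
      have h1 := eval_one_iterate_derivative_jacobiPoly (N + 1) α β 0
      rw [Function.iterate_zero, id_eq] at h1
      rw [h1]
      exact (jacobiTaylor_pos hα hN' (Nat.zero_le _)).ne'
    exact re_neg_of_resolvent_root hα hα1 hβ1 hb hzero (hpos N le_rfl) hlead hP1 hu hv hre him
      hu1 hv1
  · exact re_neg_of_resolvent_root_of_nonpos hα hα0 hb hN0 hdeg.le hzero (hpos N le_rfl)
      (hpos (N + 1) (Nat.le_succ N)) hlead hu hv hre him hu1 hv1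

theorem hasSimpleNegativeZeros_jacobiPhi {N : ℕ} {α β : ℝ} (hα : -1 < α)
    (hN : 0 < (N : ℝ) + α + β + 2)
    (h : (α < 1 ∧ -1 < β) ∨ (α ≤ 0 ∧ -2 < β ∧ 0 < N)) :
    HasSimpleNegativeZeros (jacobiPhi (N + 1) α β) ∧
      HasSimpleNegativeZeros (jacobiPhi N (α + 1) (β + 1)) := by
  have hdeg : 0 < (jacobiGen (N + 1) α β).natDegree := by
    refine Nat.lt_of_lt_of_le (Nat.succ_pos N) (le_natDegree_of_ne_zero (n := N + 1) ?_)
    rw [jacobiGen_coeff]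
    refine (jacobiTaylor_pos hα ?_ le_rfl).ne'
    push_cast
    linarith
  obtain ⟨h1, h2⟩ := hasSimpleNegativeZeros_of_stable hdeg
    (fun z hz => re_neg_of_aeval_jacobiGen_eq_zero hα hN h hz) (jacobiGen_eq_even_add_odd N hα)
  exact ⟨h1, h2.of_C_mul⟩

/-! ### The two combinations -/

lemma coeff_combination (U : ℝ[X]) (a b : ℝ) (k : ℕ) :
    (C a * U + C b * (X * derivative U)).coeff k = (a + b * k) * U.coeff k := by
  rw [coeff_add, coeff_C_mul, coeff_C_mul]
  cases k with
  | zero => simp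
  | succ k =>
    rw [coeff_X_mul, coeff_derivative]
    push_cast
    ring

lemma jacobiPhi_eq_combination (n : ℕ) {α β : ℝ} (hn : 0 < (n : ℝ) + α + β) :
    jacobiPhi n α β = C 1 * jacobiPhi n α (β - 1) +
      C (2 / (n + α + β)) * (X * derivative (jacobiPhi n α (β - 1))) := by
  ext k
  rw [coeff_combination, jacobiPhi_coeff, jacobiPhi_coeff, jacobiTaylor_eq_mul_sub_one n _ hn]
  push_cast
  field_simp

lemma jacobiPhi_eq_combination_succ (n : ℕ) {α β : ℝ} (hα : -1 < α) :
    jacobiPhi n α β = C ((n + 1) / (n + 1 + α)) * jacobiPhi (n + 1) α (β - 1) +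
      C (-2 / (n + 1 + α)) * (X * derivative (jacobiPhi (n + 1) α (β - 1))) := by
  ext k
  rw [coeff_combination, jacobiPhi_coeff, jacobiPhi_coeff, jacobiTaylor_eq_mul_succ_sub_one n _ hα]
  push_cast
  ring

theorem mainTheorem1 (α β : ℝ)
    (hαβ : (-1 < α ∧ α < 0 ∧ -1 < β) ∨ (0 ≤ α ∧ α < 1 ∧ 0 < β) ∨ (1 ≤ α ∧ α < 2 ∧ 1 < β))
    (n : ℕ) (hn : 4 ≤ n) :
    StrictlyInterlace (jacobiPhi n α β) (jacobiPhi (n - 1) α β) := by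
  obtain ⟨N, rfl⟩ : ∃ N, n = N + 1 := ⟨n - 1, by omega⟩
  have hN : (3 : ℝ) ≤ N := by exact_mod_cast (by omega : 3 ≤ N)
  have hα : -1 < α := by
    rcases hαβ with h | h | h <;> linarith [h.1]
  have hβ : -1 < β := by
    rcases hαβ with h | h | h <;> linarith [h.2.2]
  have hU : HasSimpleNegativeZeros (jacobiPhi (N + 1) α (β - 1)) := by
    rcases hαβ with h | h | h
    · exact (hasSimpleNegativeZeros_jacobiPhi hα (by linarith)
        (Or.inr ⟨h.2.1.le, by linarith, by omega⟩)).1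
    · exact (hasSimpleNegativeZeros_jacobiPhi hα (by linarith)
        (Or.inl ⟨h.2.1, by linarith [h.2.2]⟩)).1
    · -- Here `α` is too large, and the odd part for the parameters lowered by one is used.
      have h' := (hasSimpleNegativeZeros_jacobiPhi (N := N + 1) (α := α - 1) (β := β - 1 - 1)
        (by linarith [h.1]) (by push_cast; linarith)
        (Or.inl ⟨by linarith [h.2.1], by linarith [h.2.2]⟩)).2
      rwa [sub_add_cancel, sub_add_cancel] at h'
  have hdeg : 0 < (jacobiPhi (N + 1) α (β - 1)).natDegree := by
    refine Nat.lt_of_lt_of_le one_pos (le_natDegree_of_ne_zero (n := 1) ?_)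
    rw [jacobiPhi_coeff]
    refine (jacobiTaylor_pos hα ?_ (by omega)).ne'
    push_cast
    linarith
  have hs : 0 < ((N + 1 : ℕ) : ℝ) + α + β := by
    push_cast
    linarith
  rw [Nat.add_sub_cancel, jacobiPhi_eq_combination (N + 1) hs, jacobiPhi_eq_combination_succ N hα]
  refine hU.strictlyInterlace_combinations hdeg (ne_of_lt ?_)
  have h1 : 0 < (N : ℝ) + 1 + α := by linarith
  have e : 1 * (-2 / ((N : ℝ) + 1 + α)) -
      2 / (((N + 1 : ℕ) : ℝ) + α + β) * ((N + 1) / (N + 1 + α)) =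
      -(2 / (N + 1 + α) + 2 / (((N + 1 : ℕ) : ℝ) + α + β) * ((N + 1) / (N + 1 + α))) := by
    ring
  rw [e]
  have : 0 < 2 / (N + 1 + α) + 2 / (((N + 1 : ℕ) : ℝ) + α + β) * ((N + 1) / (N + 1 + α)) := by
    positivity
  linarith
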